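/- Consider the Hadamard walk on $\mathbb Z$ with amplitudes $\psi_L(n,t),\psi_R(n,t)$ at position $n\in\mathbb Z$ after $t\in\mathbb N$ steps: it starts at $n=0$ in the state $|R\rangle$, i.e. $\psi_R(0,0)=1$ and all other amplitudes at time $0$ vanish, and in each step the coin $|R\rangle\mapsto\frac1{\sqrt2}(|R\rangle+|L\rangle)$, $|L\rangle\mapsto\frac1{\sqrt2}(|R\rangle-|L\rangle)$ is applied and then the particle moves one step according to its new chirality, so that $$\psi_L(n,t+1)=\tfrac1{\sqrt2}\bigl(\psi_R(n+1,t)-\psi_L(n+1,t)\bigr),\qquad \psi_R(n,t+1)=\tfrac1{\sqrt2}\bigl(\psi_R(n-1,t)+\psi_L(n-1,t)\bigr).$$ For $1/\sqrt2<\alpha<1$ put $s=\sqrt{2\alpha^2-1}$ and $$B(\alpha)=2^{-\alpha/2}\left(\frac{1+2\alpha-s}{1+\alpha}\right)^{\alpha}\left(\frac{\alpha^2+s}{1-\alpha^2}\right)^{\frac{1-\alpha}2},$$ $$C_L(\alpha)=\left(\frac{(\alpha-s)(1+2\alpha-s)}{2\pi s(1+\alpha)(1+s)}\right)^{1/2},\qquad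 C_R(\alpha)=\frac{1+\alpha}{1-\alpha}\cdot\frac{1+s}{1+2\alpha-s}\,C_L(\alpha),$$ $$C_L^-(\alpha)=\frac{\alpha+s}{1-\alpha}\cdot\frac{1+s}{1+2\alpha-s}\,C_L(\alpha),\qquad C_R^-(\alpha)=\frac{1-\alpha}{1+\alpha}\,C_R(\alpha).$$ Let $\varepsilon>0$. Then $0<B(\alpha)<1$ for all $\alpha\in[1/\sqrt2+\varepsilon,1-\varepsilon]$. As $t\to\infty$, for integers $n\equiv t\pmod 2$ and $\alpha=n/t$, uniformly for $\alpha\in[1/\sqrt2+\varepsilon,1-\varepsilon]$ (the constants in $O(1/t)$ depend only on $\varepsilon$), $$\psi_R(n,t)=C_R(\alpha)\,t^{-1/2}B(\alpha)^t\,(1+O(1/t)),\qquad \psi_L(n,t)=C_L(\alpha)\,t^{-1/2}B(\alpha)^t\,(1+O(1/t)),$$ and, uniformly for $\alpha\in[-1+\varepsilon,-1/\sqrt2-\varepsilon]$, $$\psi_R(n,t)=(-1)^tC_R^-(|\alpha|)\,t^{-1/2}B(|\alpha|)^t\,(1+O(1/t)),\qquad \psi_L(n,t)=(-1)^{t+1}C_L^-(|\alpha|)\,t^{-1/2}B(|\alpha|)^t\,(1+O(1/t)).$$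 Consequently the amplitudes decay exponentially in both ranges, uniformly: there are $K$ and $0<q<1$ depending only on $\varepsilon$ such that $|\psi_R(n,t)|,|\psi_L(n,t)|\le Kq^t$ for all sufficiently large $t$ and all integers $n$ with $1/\sqrt2+\varepsilon\le|n/t|\le1-\varepsilon$. -/

import Mathlib

noncomputable section

namespace HadamardWalk

/-- The two chirality components (amplitudes) at one lattice point.  For the walk started at the
origin in the state `|R⟩` all amplitudes are real. -/
@[ext] structure Spinor where
  /-- amplitude of `|L⟩` -/
  L : ℝ
  /-- amplitude of `|R⟩` -/
  R : ℝ

/-- The Hadamard coin: `|R⟩ ↦ (|R⟩ + |L⟩)/√2` and `|L⟩ ↦ (|R⟩ - |L⟩)/√2`, acting on the amplitudes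
of `L |L⟩ + R |R⟩`. -/
def coin (v : Spinor) : Spinor where
  L := (v.R - v.L) / √2
  R := (v.R + v.L) / √2

/-- The particle moves one step according to its chirality: left movers go from `n + 1` to `n`,
right movers go from `n - 1` to `n`. -/
def shift (Ψ : ℤ → Spinor) : ℤ → Spinor := fun n =>
  { L := (Ψ (n + 1)).L
    R := (Ψ (n - 1)).R }

/-- The wave function after `t` steps (first the coin, then the move according to the new
chirality), started at the origin in the state `|R⟩`. -/
def Ψ : ℕ → ℤ → Spinor
  | 0 => fun n => { L := 0, R := if n = 0 then 1 else 0 }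
  | t + 1 => shift (fun n => coin (Ψ t n))

/-- The left amplitude at position `n` after `t` steps. -/
def ψL (n : ℤ) (t : ℕ) : ℝ := (Ψ t n).L

/-- The right amplitude at position `n` after `t` steps. -/
def ψR (n : ℤ) (t : ℕ) : ℝ := (Ψ t n).R

/-- The base of the exponential decay, for `1/√2 < α < 1`. -/
def B (α : ℝ) : ℝ :=
  (2 : ℝ) ^ (-α / 2) *
    ((1 + 2 * α - √(2 * α ^ 2 - 1)) / (1 + α)) ^ α *
    ((α ^ 2 + √(2 * α ^ 2 - 1)) / (1 - α ^ 2)) ^ ((1 - α) / 2)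

/-- The constant of the left amplitude, for `1/√2 < α < 1`.  With the saddle point
`ζ = (α - √(2α²-1))/(1+α)` this is `√(ζ(1+ζ) / (2π √(2α²-1) (1-ζ)))`. -/
def CL (α : ℝ) : ℝ :=
  √(((α - √(2 * α ^ 2 - 1)) * (1 + 2 * α - √(2 * α ^ 2 - 1))) /
    (2 * Real.pi * √(2 * α ^ 2 - 1) * (1 + α) * (1 + √(2 * α ^ 2 - 1))))

/-- The constant of the right amplitude, for `1/√2 < α < 1`. -/
def CR (α : ℝ) : ℝ :=
  (1 + α) / (1 - α) *
    ((1 + √(2 * α ^ 2 - 1)) / (1 + 2 * α - √(2 * α ^ 2 - 1))) * CL α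

/-- The constant of the left amplitude at the mirror image `-α` of `α`, for `1/√2 < α < 1`. -/
def CLneg (α : ℝ) : ℝ :=
  ((α + √(2 * α ^ 2 - 1)) / (1 - α)) *
    ((1 + √(2 * α ^ 2 - 1)) / (1 + 2 * α - √(2 * α ^ 2 - 1))) * CL α

/-- The constant of the right amplitude at the mirror image `-α` of `α`, for `1/√2 < α < 1`. -/
def CRneg (α : ℝ) : ℝ := (1 - α) / (1 + α) * CR α

end HadamardWalk

end

/-!
# Exponentially small amplitudes of the Hadamard walk

After `l` moves to the left and `r` moves to the right, with `t = l + r` and `n = r - l`, the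
amplitudes are `2^{-t/2}` times coefficients of `(1 - X)^{l-1} (1 + X)^r` (`Ψ_eq_coeff`). By Cauchy's
formula (`coeff_eq_integral`) such a coefficient is an integral over a circle `z = ζ e^{iθ}` of
`(1 - z)^l (1 + z)^r / z^l` times a prefactor, `z / (1 - z)` for the left and `1 / (1 - z)` for the
right amplitude. For negative `n` the symmetries `X ↦ -X` and `X ↦ 1/X` exchange `l` and `r`
(`leftCoeff_eq_reversed`, `rightCoeff_eq_reversed`), and the prefactors become `1 / (1 + z)` and
`z / (1 + z)`.

With `α = n / t`, the radius is the saddle point `ζ = (α - s) / (1 + α)`, `s = √(2α² - 1)`, which lies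
in `(0, √2 - 1)`. The integrand is its value at `z = ζ` times `exp (t * phase α θ)`, and the phase is
`-v θ² / 2 + i c θ³ + O(θ⁴)` with real `c` and curvature `v = s ζ / (1 - ζ²)` (`norm_phase_sub_le`).
On the whole circle its real part is at most `-v θ² / 5` (`re_phase_le`), so no other point of the
circle contributes. In `norm_laplace_integral_sub_le` the integrand is compared pointwise with the
Gaussian and its first odd correction; the odd correction integrates to zero and the remainder is
`O(1/t)` times a Gaussian. Every constant depends only on bounds for `ζ` and `v`, which hold
uniformly in terms of `ε`.

The saddle point value, divided by `2^{t/2}`, is `B(α)^t` (`B_pow`). At the point `√2 - 1` the same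
expression would give `1` for every `α`, and the modulus increases strictly along the real axis from
`ζ` to `√2 - 1`; hence `B(α) < 1` (`B_lt_one`). The uniform exponential decay follows since `B` is
continuous on a compact interval and the amplitudes vanish for `n` of the wrong parity.
-/

/-! ### The walk as coefficients of `(1 - X)^a (1 + X)^b` -/

namespace HadamardWalk

open Polynomial

/-- The left amplitude after `l` moves to the left and `r` moves to the right, times `2^{t/2}` for
`t = l + r`. -/
noncomputable def leftCoeff : ℕ → ℕ → ℝ
  | 0, _ => 0
  | l + 1, r => ((1 - X : ℝ[X]) ^ l * (1 + X) ^ r).coeff l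

/-- The right amplitude after `l` moves to the left and `r` moves to the right, times `2^{t/2}` for
`t = l + r`. The case `l = 0` is the single path that always moves to the right. -/
noncomputable def rightCoeff : ℕ → ℕ → ℝ
  | 0, _ => 1
  | l + 1, r => ((1 - X : ℝ[X]) ^ l * (1 + X) ^ r).coeff (l + 1)

theorem leftCoeff_succ (l r : ℕ) :
    leftCoeff (l + 1) r = rightCoeff l r - leftCoeff l r := by
  cases l with
  | zero => simp [leftCoeff, rightCoeff, coeff_zero_eq_eval_zero]
  | succ l =>
    have h : ((1 - X : ℝ[X]) ^ (l + 1) * (1 + X) ^ r) =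
        (1 - X : ℝ[X]) ^ l * (1 + X) ^ r - (1 - X : ℝ[X]) ^ l * (1 + X) ^ r * X := by ring
    simp only [leftCoeff, rightCoeff]
    rw [h, coeff_sub, coeff_mul_X]

theorem rightCoeff_succ (l r : ℕ) :
    rightCoeff l (r + 1) = rightCoeff l r + leftCoeff l r := by
  cases l with
  | zero => simp [leftCoeff, rightCoeff]
  | succ l =>
    have h : ((1 - X : ℝ[X]) ^ l * (1 + X) ^ (r + 1)) =
        (1 - X : ℝ[X]) ^ l * (1 + X) ^ r + (1 - X : ℝ[X]) ^ l * (1 + X) ^ r * X := by ring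
    simp only [leftCoeff, rightCoeff]
    rw [h, coeff_add, coeff_mul_X]

theorem natDegree_one_sub_X_pow_le (l : ℕ) : ((1 - X : ℝ[X]) ^ l).natDegree ≤ l := by
  have h : (1 - X : ℝ[X]).natDegree ≤ 1 := by compute_degree
  simpa using natDegree_pow_le_of_le l h

theorem natDegree_one_add_X_pow_le (r : ℕ) : ((1 + X : ℝ[X]) ^ r).natDegree ≤ r := by
  have h : (1 + X : ℝ[X]).natDegree ≤ 1 := by compute_degree
  simpa using natDegree_pow_le_of_le r h

theorem rightCoeff_succ_zero (l : ℕ) : rightCoeff (l + 1) 0 = 0 := by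
  simp only [rightCoeff, pow_zero, mul_one]
  exact coeff_eq_zero_of_natDegree_lt (Nat.lt_succ_of_le (natDegree_one_sub_X_pow_le l))

theorem Ψ_succ_L (t : ℕ) (n : ℤ) :
    (Ψ (t + 1) n).L = ((Ψ t (n + 1)).R - (Ψ t (n + 1)).L) / √2 := rfl

theorem Ψ_succ_R (t : ℕ) (n : ℤ) :
    (Ψ (t + 1) n).R = ((Ψ t (n - 1)).R + (Ψ t (n - 1)).L) / √2 := rfl

/-- The walk lives on the lattice points of the parity of `t` in `[-t, t]`. -/
theorem Ψ_eq_zero (t : ℕ) (n : ℤ) (h : (t : ℤ) < |n| ∨ ¬ n ≡ (t : ℤ) [ZMOD 2]) :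
    (Ψ t n).L = 0 ∧ (Ψ t n).R = 0 := by
  induction t generalizing n with
  | zero =>
    have hn : n ≠ 0 := by
      rintro rfl
      simp at h
    simp [Ψ, hn]
  | succ t ih =>
    have h1 := ih (n + 1) (by simp only [Int.ModEq] at *; push_cast at h; grind)
    have h2 := ih (n - 1) (by simp only [Int.ModEq] at *; push_cast at h; grind)
    rw [Ψ_succ_L, Ψ_succ_R, h1.1, h1.2, h2.1, h2.2]
    simp

theorem Ψ_eq_coeff (t l r : ℕ) (h : l + r = t) :
    (Ψ t ((r : ℤ) - l)).L = leftCoeff l r / √2 ^ t ∧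
      (Ψ t ((r : ℤ) - l)).R = rightCoeff l r / √2 ^ t := by
  induction t generalizing l r with
  | zero =>
    obtain ⟨rfl, rfl⟩ : l = 0 ∧ r = 0 := by omega
    simp [Ψ, leftCoeff, rightCoeff]
  | succ t ih =>
    rw [Ψ_succ_L, Ψ_succ_R, pow_succ, ← div_div, ← div_div]
    constructor
    · congr 1
      cases l with
      | zero =>
        have h1 := Ψ_eq_zero t ((r : ℤ) - (0 : ℕ) + 1) (Or.inl (by rw [abs_of_pos] <;> omega))
        rw [h1.1, h1.2]
        simp [leftCoeff]
      | succ l =>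
        have h1 := ih l r (by omega)
        rw [show (r : ℤ) - ((l + 1 : ℕ) : ℤ) + 1 = r - l by push_cast; ring, h1.1, h1.2,
          leftCoeff_succ, sub_div]
    · congr 1
      cases r with
      | zero =>
        have h1 := Ψ_eq_zero t (((0 : ℕ) : ℤ) - l - 1) (Or.inl (by rw [abs_of_neg] <;> omega))
        rw [h1.1, h1.2]
        obtain ⟨l, rfl⟩ : ∃ k, l = k + 1 := ⟨l - 1, by omega⟩
        simp [rightCoeff_succ_zero]
      | succ r =>
        have h1 := ih l r (by omega)
        rw [show ((r + 1 : ℕ) : ℤ) - l - 1 = r - l by push_cast; ring, h1.1, h1.2,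
          rightCoeff_succ, add_div]

/-- Reversing the coefficients of `(1 - X) ^ a * (1 + X) ^ b` multiplies them by `(-1) ^ a`. -/
theorem coeff_reverse_one_sub_X_pow_mul (a b k m : ℕ) (h : k + m = a + b) :
    ((1 - X : ℝ[X]) ^ a * (1 + X) ^ b).coeff k =
      (-1) ^ a * ((1 - X : ℝ[X]) ^ a * (1 + X) ^ b).coeff m := by
  have h1 : ∀ a : ℕ, reflect a ((1 - X : ℝ[X]) ^ a) = (-1) ^ a * (1 - X) ^ a := by
    intro a
    induction a with
    | zero => simp
    | succ a ih =>
      have hX : reflect 1 (1 - X : ℝ[X]) = -1 * (1 - X) := by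
        rw [reflect_sub, reflect_one_X, reflect_one]; simp
      rw [pow_succ, reflect_mul _ _ (natDegree_one_sub_X_pow_le a) (by compute_degree), ih, hX]
      ring
  have h2 : ∀ b : ℕ, reflect b ((1 + X : ℝ[X]) ^ b) = (1 + X) ^ b := by
    intro b
    induction b with
    | zero => simp
    | succ b ih =>
      have hX : reflect 1 (1 + X : ℝ[X]) = 1 + X := by
        rw [reflect_add, reflect_one_X, reflect_one]; simp [add_comm]
      rw [pow_succ, reflect_mul _ _ (natDegree_one_add_X_pow_le b) (by compute_degree), ih, hX]
  have h3 : reflect (a + b) ((1 - X : ℝ[X]) ^ a * (1 + X) ^ b) =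
      C ((-1) ^ a) * ((1 - X : ℝ[X]) ^ a * (1 + X) ^ b) := by
    rw [reflect_mul _ _ (natDegree_one_sub_X_pow_le a) (natDegree_one_add_X_pow_le b), h1, h2]
    simp [mul_assoc]
  have h4 := congrArg (fun p => coeff p m) h3
  simp only [coeff_reflect, coeff_C_mul] at h4
  rw [revAt_le (by omega), show a + b - m = k by omega] at h4
  exact h4

/-- Substituting `-X` for `X` exchanges the factors `1 - X` and `1 + X`. -/
theorem coeff_one_sub_X_pow_mul_comp_neg (a b k : ℕ) :
    ((1 - X : ℝ[X]) ^ a * (1 + X) ^ b).coeff k =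
      (-1) ^ k * ((1 - X : ℝ[X]) ^ b * (1 + X) ^ a).coeff k := by
  have h := comp_C_mul_X_coeff (p := (1 - X : ℝ[X]) ^ b * (1 + X) ^ a) (r := -1) (n := k)
  rw [mul_comm ((-1) ^ k), ← h]
  congr 1
  simp only [mul_comp, pow_comp, sub_comp, add_comp, one_comp, X_comp, map_neg, map_one]
  ring

theorem leftCoeff_eq_reversed (l r : ℕ) :
    leftCoeff (l + 1) r = (-1) ^ (l + r) * ((1 - X : ℝ[X]) ^ r * (1 + X) ^ l).coeff r := by
  simp only [leftCoeff]
  rw [coeff_one_sub_X_pow_mul_comp_neg, coeff_reverse_one_sub_X_pow_mul r l l r (by ring), pow_add]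
  ring

theorem rightCoeff_eq_reversed (l r : ℕ) :
    rightCoeff (l + 1) (r + 1) =
      (-1) ^ (l + r) * ((1 - X : ℝ[X]) ^ (r + 1) * (1 + X) ^ l).coeff r := by
  simp only [rightCoeff]
  rw [coeff_one_sub_X_pow_mul_comp_neg,
    coeff_reverse_one_sub_X_pow_mul (r + 1) l (l + 1) r (by ring)]
  ring

end HadamardWalk

/-! ### Cauchy's formula and expansions on the circle -/

namespace HadamardWalk

open Polynomial Complex MeasureTheory

theorem integral_exp_int_mul_I (k : ℤ) :
    ∫ θ in (-Real.pi)..Real.pi, exp (k * (θ * I)) = if k = 0 then 2 * Real.pi else 0 := by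
  split_ifs with hk
  · simp [hk]; ring
  · have h : (k : ℂ) * I ≠ 0 := by simp [hk]
    have h1 := integral_exp_mul_complex (a := -Real.pi) (b := Real.pi) h
    have h2 : ∀ θ : ℝ, (k : ℂ) * I * θ = k * (θ * I) := fun θ => by ring
    simp only [h2] at h1
    rw [h1, ofReal_zero, div_eq_zero_iff]
    left
    rw [sub_eq_zero, Complex.exp_eq_exp_iff_exists_int]
    exact ⟨k, by push_cast; ring⟩

/-- Cauchy's coefficient formula on the circle of radius `ρ`. -/
theorem coeff_eq_integral (p : ℝ[X]) (m : ℕ) (ρ : ℝ) (hρ : 0 < ρ) :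
    ∫ θ in (-Real.pi)..Real.pi, aeval ((ρ : ℂ) * exp (θ * I)) p / ((ρ : ℂ) * exp (θ * I)) ^ m =
      2 * Real.pi * (p.coeff m : ℂ) := by
  have hρ' : (ρ : ℂ) ≠ 0 := by exact_mod_cast hρ.ne'
  have h1 : ∀ θ : ℝ, aeval ((ρ : ℂ) * exp (θ * I)) p / ((ρ : ℂ) * exp (θ * I)) ^ m =
      ∑ k ∈ p.support,
        ((p.coeff k : ℂ) * ρ ^ ((k : ℤ) - m)) * exp (((k : ℤ) - m : ℤ) * (θ * I)) := by
    intro θ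
    rw [aeval_def, eval₂_eq_sum, Polynomial.sum, Finset.sum_div]
    refine Finset.sum_congr rfl fun k _ => ?_
    have h0 : (ρ : ℂ) * exp (θ * I) ≠ 0 := mul_ne_zero hρ' (exp_ne_zero _)
    rw [mul_div_assoc, ← zpow_natCast _ k, ← zpow_natCast _ m, ← zpow_sub₀ h0, mul_zpow,
      ← exp_int_mul, ← mul_assoc]
    rfl
  simp only [h1]
  rw [intervalIntegral.integral_finsetSum]
  · simp only [intervalIntegral.integral_const_mul, integral_exp_int_mul_I]
    rw [Finset.sum_eq_single m]
    · simp; ring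
    · intro k _ hk
      rw [if_neg (by omega), ofReal_zero, mul_zero]
    · intro hm
      simp [notMem_support_iff.mp hm]
  · intro k _
    exact (by fun_prop : Continuous _).intervalIntegrable _ _

/-- Integrating a bound on the derivative raises the order of vanishing at `0` by one. -/
theorem norm_le_of_norm_deriv_le {f f' : ℝ → ℂ} {C : ℝ} (hC : 0 ≤ C) (k : ℕ)
    (hf : ∀ x, HasDerivAt f (f' x) x) (h0 : f 0 = 0) (h : ∀ x, ‖f' x‖ ≤ C * |x| ^ k) (x : ℝ) :
    ‖f x‖ ≤ C * |x| ^ (k + 1) := by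
  have h1 := (convex_Icc (-|x|) |x|).norm_image_sub_le_of_norm_hasDerivWithin_le
    (f := f) (f' := f') (C := C * |x| ^ k) (x := 0) (y := x)
    (fun y _ => (hf y).hasDerivWithinAt)
    (fun y hy => (h y).trans (by
      have : |y| ≤ |x| := abs_le.mpr hy
      gcongr))
    ⟨by simp, abs_nonneg x⟩ ⟨neg_abs_le x, le_abs_self x⟩
  rw [h0, sub_zero, sub_zero, Real.norm_eq_abs] at h1
  rw [pow_succ, ← mul_assoc]
  exact h1

/-- The function `w = 1 / (1 + ξ e^{iθ})` of the angle. It satisfies `w' = -i (w - w²)`, so that all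
derivatives of `w` and of `log (1 + ξ e^{iθ})` are polynomials in `w`. -/
noncomputable def circInv (ξ θ : ℝ) : ℂ := (1 + (ξ : ℂ) * exp (θ * I))⁻¹

theorem norm_real_mul_exp (ξ θ : ℝ) : ‖(ξ : ℂ) * exp (θ * I)‖ = |ξ| := by
  simp [norm_exp_ofReal_mul_I]

theorem one_add_mem_slitPlane {ξ : ℝ} (hξ : |ξ| ≤ 1 / 2) (θ : ℝ) :
    1 + (ξ : ℂ) * exp (θ * I) ∈ slitPlane :=
  mem_slitPlane_of_norm_lt_one (by rw [norm_real_mul_exp]; linarith)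

theorem norm_circInv_le {ξ : ℝ} (hξ : |ξ| ≤ 1 / 2) (θ : ℝ) : ‖circInv ξ θ‖ ≤ 2 := by
  have h1 := norm_sub_norm_le (1 : ℂ) (-((ξ : ℂ) * exp (θ * I)))
  rw [norm_neg, norm_real_mul_exp, norm_one, sub_neg_eq_add] at h1
  rw [circInv, norm_inv]
  exact inv_le_of_inv_le₀ (by norm_num) (by linarith)

theorem hasDerivAt_one_add (ξ θ : ℝ) :
    HasDerivAt (fun θ : ℝ => 1 + (ξ : ℂ) * exp (θ * I)) ((ξ : ℂ) * exp (θ * I) * I) θ := by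
  have h1 : HasDerivAt (fun z : ℂ => 1 + (ξ : ℂ) * exp (z * I)) ((ξ : ℂ) * exp (θ * I) * I) θ := by
    have := ((((hasDerivAt_id (θ : ℂ)).mul_const I).cexp).const_mul (ξ : ℂ)).const_add 1
    simpa [mul_assoc] using this
  exact h1.comp_ofReal

theorem hasDerivAt_circInv {ξ : ℝ} (hξ : |ξ| ≤ 1 / 2) (θ : ℝ) :
    HasDerivAt (circInv ξ) (-I * (circInv ξ θ - circInv ξ θ ^ 2)) θ := by
  have h0 := slitPlane_ne_zero (one_add_mem_slitPlane hξ θ)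
  have h1 := (hasDerivAt_one_add ξ θ).inv h0
  refine h1.congr_deriv ?_
  simp only [circInv]
  field_simp
  ring

theorem hasDerivAt_log_one_add {ξ : ℝ} (hξ : |ξ| ≤ 1 / 2) (θ : ℝ) :
    HasDerivAt (fun θ : ℝ => log (1 + (ξ : ℂ) * exp (θ * I))) (I * (1 - circInv ξ θ)) θ := by
  have h0 := slitPlane_ne_zero (one_add_mem_slitPlane hξ θ)
  have h1 := (hasDerivAt_one_add ξ θ).clog_real (one_add_mem_slitPlane hξ θ)
  refine h1.congr_deriv ?_
  rw [circInv, div_eq_iff h0, mul_assoc I, sub_mul, inv_mul_cancel₀ h0]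
  ring

theorem circInv_zero (ξ : ℝ) : circInv ξ 0 = (((1 + ξ)⁻¹ : ℝ) : ℂ) := by
  simp [circInv]

/-- First order expansion of `1 / (1 + ξ e^{iθ})`. -/
theorem norm_circInv_sub_le {ξ : ℝ} (hξ : |ξ| ≤ 1 / 2) (θ : ℝ) :
    ‖circInv ξ θ - circInv ξ 0 - (-I * (circInv ξ 0 - circInv ξ 0 ^ 2)) * θ‖ ≤ 30 * θ ^ 2 := by
  have hb := norm_circInv_le hξ
  -- the second derivative of `w = circInv ξ` is `-(1 - 2w)(w - w²)`
  have e2 : ∀ x : ℝ, HasDerivAt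
      (fun x => -I * (circInv ξ x - circInv ξ x ^ 2) - (-I * (circInv ξ 0 - circInv ξ 0 ^ 2)))
      (-((1 - 2 * circInv ξ x) * (circInv ξ x - circInv ξ x ^ 2))) x := by
    intro x
    have hw := hasDerivAt_circInv hξ x
    refine HasDerivAt.congr_deriv (((hw.sub (hw.pow 2)).const_mul (-I)).sub_const
      (-I * (circInv ξ 0 - circInv ξ 0 ^ 2))) ?_
    push_cast
    linear_combination ((1 - 2 * circInv ξ x) * (circInv ξ x - circInv ξ x ^ 2)) * I_sq
  have e1 : ∀ x : ℝ, HasDerivAt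
      (fun x : ℝ => circInv ξ x - circInv ξ 0 - (-I * (circInv ξ 0 - circInv ξ 0 ^ 2)) * x)
      (-I * (circInv ξ x - circInv ξ x ^ 2) - (-I * (circInv ξ 0 - circInv ξ 0 ^ 2))) x := by
    intro x
    have hx : HasDerivAt (fun x : ℝ => (x : ℂ)) 1 x := ofRealCLM.hasDerivAt
    refine HasDerivAt.congr_deriv (((hasDerivAt_circInv hξ x).sub_const (circInv ξ 0)).sub
      (hx.const_mul (-I * (circInv ξ 0 - circInv ξ 0 ^ 2)))) ?_
    ring
  have b2 : ∀ x, ‖-((1 - 2 * circInv ξ x) * (circInv ξ x - circInv ξ x ^ 2))‖ ≤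
      30 * |x| ^ 0 := by
    intro x
    rw [norm_neg, norm_mul, pow_zero]
    have h1 : ‖1 - 2 * circInv ξ x‖ ≤ 1 + 2 * 2 := by
      refine (norm_sub_le _ _).trans ?_
      rw [norm_mul, norm_one]
      have := hb x
      norm_num
      linarith
    have h2 : ‖circInv ξ x - circInv ξ x ^ 2‖ ≤ 2 + 2 ^ 2 := by
      refine (norm_sub_le _ _).trans ?_
      rw [norm_pow]
      have := hb x
      gcongr
    calc _ ≤ (1 + 2 * 2) * (2 + 2 ^ 2 : ℝ) := by gcongr
      _ = _ := by norm_num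
  have b1 := norm_le_of_norm_deriv_le (by norm_num) 0 e2 (by simp) b2
  have b0 := norm_le_of_norm_deriv_le (by norm_num) 1 e1 (by simp) b1 θ
  simpa using b0

/-- Third order expansion of `log (1 + ξ e^{iθ})`. -/
theorem norm_log_one_add_sub_le {ξ : ℝ} (hξ : |ξ| ≤ 1 / 2) (θ : ℝ) :
    ‖log (1 + (ξ : ℂ) * exp (θ * I)) - log (1 + (ξ : ℂ)) - I * (1 - circInv ξ 0) * θ
        + (circInv ξ 0 - circInv ξ 0 ^ 2) * θ ^ 2 / 2
        - I * (1 - 2 * circInv ξ 0) * (circInv ξ 0 - circInv ξ 0 ^ 2) * θ ^ 3 / 6‖ ≤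
      222 * θ ^ 4 := by
  set u := circInv ξ 0 with hu
  have hb := norm_circInv_le hξ
  have hx : ∀ x : ℝ, HasDerivAt (fun x : ℝ => (x : ℂ)) 1 x := fun x => ofRealCLM.hasDerivAt
  have hw := hasDerivAt_circInv hξ
  -- the constant is a bound for the fourth derivative `(1 - 6w + 6w²)(w - w²)`, as `‖w‖ ≤ 2`
  have e1 : ∀ x : ℝ, HasDerivAt
      (fun x : ℝ => log (1 + (ξ : ℂ) * exp (x * I)) - log (1 + (ξ : ℂ)) - I * (1 - u) * x
        + (u - u ^ 2) * x ^ 2 / 2 - I * (1 - 2 * u) * (u - u ^ 2) * x ^ 3 / 6)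
      (I * (1 - circInv ξ x) - I * (1 - u) + (u - u ^ 2) * x
        - I * (1 - 2 * u) * (u - u ^ 2) * x ^ 2 / 2) x := by
    intro x
    refine HasDerivAt.congr_deriv (((((hasDerivAt_log_one_add hξ x).sub_const (log (1 + (ξ : ℂ)))).sub
      ((hx x).const_mul (I * (1 - u)))).add
      ((((hx x).pow 2).const_mul (u - u ^ 2)).div_const 2)).sub
      ((((hx x).pow 3).const_mul (I * (1 - 2 * u) * (u - u ^ 2))).div_const 6)) ?_
    push_cast
    ring
  have e2 : ∀ x : ℝ, HasDerivAt
      (fun x : ℝ => I * (1 - circInv ξ x) - I * (1 - u) + (u - u ^ 2) * x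
        - I * (1 - 2 * u) * (u - u ^ 2) * x ^ 2 / 2)
      (-(circInv ξ x - circInv ξ x ^ 2) + (u - u ^ 2)
        - I * (1 - 2 * u) * (u - u ^ 2) * x) x := by
    intro x
    refine HasDerivAt.congr_deriv ((((((hw x).const_sub 1).const_mul I).sub_const (I * (1 - u))).add
      ((hx x).const_mul (u - u ^ 2))).sub
      ((((hx x).pow 2).const_mul (I * (1 - 2 * u) * (u - u ^ 2))).div_const 2)) ?_
    push_cast
    linear_combination (circInv ξ x - circInv ξ x ^ 2) * I_sq
  have e3 : ∀ x : ℝ, HasDerivAt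
      (fun x : ℝ => -(circInv ξ x - circInv ξ x ^ 2) + (u - u ^ 2)
        - I * (1 - 2 * u) * (u - u ^ 2) * x)
      (I * (1 - 2 * circInv ξ x) * (circInv ξ x - circInv ξ x ^ 2)
        - I * (1 - 2 * u) * (u - u ^ 2)) x := by
    intro x
    refine HasDerivAt.congr_deriv (((((hw x).sub ((hw x).pow 2)).neg).add_const (u - u ^ 2)).sub
      ((hx x).const_mul (I * (1 - 2 * u) * (u - u ^ 2)))) ?_
    push_cast
    ring
  have e4 : ∀ x : ℝ, HasDerivAt
      (fun x : ℝ => I * (1 - 2 * circInv ξ x) * (circInv ξ x - circInv ξ x ^ 2)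
        - I * (1 - 2 * u) * (u - u ^ 2))
      ((1 - 6 * circInv ξ x + 6 * circInv ξ x ^ 2) * (circInv ξ x - circInv ξ x ^ 2)) x := by
    intro x
    refine HasDerivAt.congr_deriv (((((((hw x).const_mul 2).const_sub 1).const_mul I).mul
      ((hw x).sub ((hw x).pow 2))).sub_const (I * (1 - 2 * u) * (u - u ^ 2)))) ?_
    simp only [Pi.sub_apply, Pi.pow_apply]
    push_cast
    linear_combination
      (-(1 - 6 * circInv ξ x + 6 * circInv ξ x ^ 2) * (circInv ξ x - circInv ξ x ^ 2)) * I_sq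
  have b4 : ∀ x, ‖(1 - 6 * circInv ξ x + 6 * circInv ξ x ^ 2) *
      (circInv ξ x - circInv ξ x ^ 2)‖ ≤ 222 * |x| ^ 0 := by
    intro x
    rw [norm_mul, pow_zero]
    have h1 : ‖1 - 6 * circInv ξ x + 6 * circInv ξ x ^ 2‖ ≤ 1 + 6 * 2 + 6 * 2 ^ 2 := by
      refine (norm_add_le _ _).trans (add_le_add ((norm_sub_le _ _).trans ?_) ?_)
      · rw [norm_mul, norm_one]
        have := hb x
        norm_num
        linarith
      · rw [norm_mul, norm_pow]
        have := hb x
        norm_num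
        nlinarith [norm_nonneg (circInv ξ x)]
    have h2 : ‖circInv ξ x - circInv ξ x ^ 2‖ ≤ 2 + 2 ^ 2 := by
      refine (norm_sub_le _ _).trans ?_
      rw [norm_pow]
      have := hb x
      gcongr
    calc _ ≤ (1 + 6 * 2 + 6 * 2 ^ 2) * (2 + 2 ^ 2 : ℝ) := by gcongr
      _ = _ := by norm_num
  have b3 := norm_le_of_norm_deriv_le (by norm_num) 0 e4 (by simp [hu]) b4
  have b2 := norm_le_of_norm_deriv_le (by norm_num) 1 e3 (by simp [hu]) b3
  have b1 := norm_le_of_norm_deriv_le (by norm_num) 2 e2 (by simp [hu]) b2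
  have b0 := norm_le_of_norm_deriv_le (by norm_num) 3 e1 (by simp) b1 θ
  have h4 : |θ| ^ (3 + 1) = θ ^ 4 := by
    rw [← abs_pow]
    exact abs_of_nonneg (Even.pow_nonneg (by decide) θ)
  rwa [h4] at b0

end HadamardWalk

/-! ### Laplace's method with a uniform error -/

namespace HadamardWalk

open Complex MeasureTheory

theorem norm_exp_sub_exp_le {m : ℝ} {a b : ℂ} (ha : a.re ≤ -m) (hb : b.re ≤ -m) :
    ‖exp a - exp b‖ ≤ Real.exp (-m) * ‖a - b‖ := by
  refine (convex_halfSpace_re_le (-m)).norm_image_sub_le_of_norm_hasDerivWithin_le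
    (f := exp) (f' := exp) (fun z _ => (hasDerivAt_exp z).hasDerivWithinAt) (fun z hz => ?_) hb ha
  rw [norm_exp]
  exact Real.exp_le_exp.mpr hz

theorem norm_exp_sub_exp_sub_le {m : ℝ} {a b : ℂ} (ha : a.re ≤ -m) (hb : b.re ≤ -m) :
    ‖exp a - exp b - exp b * (a - b)‖ ≤ Real.exp (-m) * ‖a - b‖ ^ 2 := by
  have hconv : Convex ℝ ({z : ℂ | z.re ≤ -m} ∩ Metric.closedBall b ‖a - b‖) :=
    (convex_halfSpace_re_le (-m)).inter (convex_closedBall _ _)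
  have h := hconv.norm_image_sub_le_of_norm_hasDerivWithin_le
    (f := fun z => exp z - exp b * z) (f' := fun z => exp z - exp b)
    (C := Real.exp (-m) * ‖a - b‖) (x := b) (y := a)
    (fun z _ => by
      have := (hasDerivAt_exp z).sub ((hasDerivAt_id z).const_mul (exp b))
      rw [mul_one] at this
      exact this.hasDerivWithinAt)
    (fun z hz => (norm_exp_sub_exp_le hz.1 hb).trans (by
      have h2 : ‖z - b‖ ≤ ‖a - b‖ := by simpa [dist_eq_norm] using hz.2
      gcongr))
    ⟨hb, by simp⟩ ⟨ha, by simp [dist_eq_norm]⟩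
  calc ‖exp a - exp b - exp b * (a - b)‖ = ‖exp a - exp b * a - (exp b - exp b * b)‖ := by
        congr 1; ring
    _ ≤ _ := h
    _ = _ := by ring

/-- The constant in the pointwise estimate of the Laplace method. -/
noncomputable def laplaceConst (κ M : ℝ) : ℝ :=
  M * (2 / κ) + 6 * M ^ 2 * (2 * (2 / κ) ^ 2) + 25 * M ^ 3 * (6 * (2 / κ) ^ 3)

/-- Half of the Gaussian decay absorbs a cubic polynomial. -/
theorem cubic_mul_exp_le {κ M u : ℝ} (hκ : 0 < κ) (hM : 0 ≤ M) (hu : 0 ≤ u) :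
    (M * u + 6 * M ^ 2 * u ^ 2 + 25 * M ^ 3 * u ^ 3) * Real.exp (-(κ * u)) ≤
      laplaceConst κ M * Real.exp (-(κ / 2) * u) := by
  set x := κ * u / 2 with hx
  have hx0 : 0 ≤ x := by positivity
  have hux : u = 2 / κ * x := by rw [hx]; field_simp
  have he : Real.exp (-(κ * u)) = Real.exp (-x) * Real.exp (-x) := by
    rw [← Real.exp_add]; congr 1; rw [hx]; ring
  have he2 : Real.exp (-(κ / 2) * u) = Real.exp (-x) := by congr 1; rw [hx]; ring
  have key : ∀ k : ℕ, x ^ k * Real.exp (-x) ≤ (k.factorial : ℝ) := by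
    intro k
    have h1 := Real.pow_div_factorial_le_exp x hx0 k
    rw [div_le_iff₀ (by positivity)] at h1
    rw [Real.exp_neg, ← div_eq_mul_inv, div_le_iff₀ (Real.exp_pos _)]
    linarith
  have k1 := key 1
  have k2 := key 2
  have k3 := key 3
  norm_num [Nat.factorial] at k1 k2 k3
  rw [he, he2, ← mul_assoc]
  refine mul_le_mul_of_nonneg_right ?_ (Real.exp_pos _).le
  have hκ2 : 0 ≤ 2 / κ := by positivity
  calc (M * u + 6 * M ^ 2 * u ^ 2 + 25 * M ^ 3 * u ^ 3) * Real.exp (-x)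
      = M * (2 / κ) * (x * Real.exp (-x)) + 6 * M ^ 2 * (2 / κ) ^ 2 * (x ^ 2 * Real.exp (-x)) +
          25 * M ^ 3 * (2 / κ) ^ 3 * (x ^ 3 * Real.exp (-x)) := by rw [hux]; ring
    _ ≤ M * (2 / κ) * 1 + 6 * M ^ 2 * (2 / κ) ^ 2 * 2 + 25 * M ^ 3 * (2 / κ) ^ 3 * 6 := by
        gcongr
    _ = laplaceConst κ M := by rw [laplaceConst]; ring

/-- The integrand of the Laplace method minus its Gaussian approximation, corrected by the
odd terms of the next order. -/
theorem norm_laplace_integrand_sub_le {κ M v c g₀ g₁ t θ : ℝ} {p q : ℂ} (hκ : 0 < κ)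
    (hM : 0 ≤ M) (hv : 2 * κ ≤ v) (hc : |c| ≤ M) (hg₀ : |g₀| ≤ M) (hg₁ : |g₁| ≤ M)
    (hθ : |θ| ≤ 4) (ht : 0 < t)
    (hp : ‖p + v * θ ^ 2 / 2 - I * c * θ ^ 3‖ ≤ M * θ ^ 4) (hre : p.re ≤ -κ * θ ^ 2)
    (hq : ‖q - g₀ - I * g₁ * θ‖ ≤ M * θ ^ 2) :
    ‖q * exp (t * p) - exp (-(t * v / 2 : ℝ) * θ ^ 2) * (I * (g₁ * θ + g₀ * c * t * θ ^ 3))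
        - g₀ * exp (-(t * v / 2 : ℝ) * θ ^ 2)‖ ≤
      laplaceConst κ M / t * Real.exp (-(κ / 2 * t) * θ ^ 2) := by
  set A : ℂ := t * p with hA
  set A₀ : ℂ := -(t * v / 2 : ℝ) * θ ^ 2 with hA₀
  set u := t * θ ^ 2 with hu
  set E := Real.exp (-(κ * u)) with hE
  have hu0 : 0 ≤ u := by positivity
  have hAre : A.re ≤ -(κ * u) := by
    rw [hA, re_ofReal_mul, hu]
    nlinarith
  have hA₀re : A₀.re ≤ -(κ * u) := by
    have : A₀ = ((-(t * v / 2) * θ ^ 2 : ℝ) : ℂ) := by rw [hA₀]; push_cast; ring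
    rw [this, ofReal_re, hu]
    nlinarith [mul_nonneg ht.le (sq_nonneg θ)]
  set R : ℂ := p + v * θ ^ 2 / 2 - I * c * θ ^ 3 with hR
  have hD : A - A₀ = t * R + I * (c * t * θ ^ 3) := by
    rw [hA, hA₀, hR]; push_cast; ring
  have hθ4 : θ ^ 4 = |θ| ^ 4 := ((by decide : Even 4).pow_abs θ).symm
  have hθ2 : θ ^ 2 = |θ| ^ 2 := (sq_abs θ).symm
  have hDle : ‖A - A₀‖ ≤ 5 * M * t * |θ| ^ 3 := by
    rw [hD]
    refine (norm_add_le _ _).trans ?_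
    rw [norm_mul, norm_mul, norm_mul, norm_mul, norm_pow, norm_I]
    simp only [norm_real, Real.norm_eq_abs, abs_of_pos ht]
    have h1 : |c| * t * |θ| ^ 3 ≤ M * t * |θ| ^ 3 := by gcongr
    have h2 : t * ‖R‖ ≤ t * (M * θ ^ 4) := by gcongr
    have h3 : M * t * |θ| ^ 3 * |θ| ≤ M * t * |θ| ^ 3 * 4 := by gcongr
    rw [hθ4] at h2
    nlinarith
  have hexpA : ‖exp A‖ ≤ E := by rw [norm_exp]; exact Real.exp_le_exp.mpr hAre
  have hexpA₀ : ‖exp A₀‖ ≤ E := by rw [norm_exp]; exact Real.exp_le_exp.mpr hA₀re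
  have b1 := norm_exp_sub_exp_le hAre hA₀re
  have b2 := norm_exp_sub_exp_sub_le hAre hA₀re
  rw [← hE] at b1 b2
  have hE0 : 0 < E := Real.exp_pos _
  have dec : q * exp A - exp A₀ * (I * (g₁ * θ + g₀ * c * t * θ ^ 3)) - g₀ * exp A₀ =
      (q - g₀ - I * g₁ * θ) * exp A + (I * g₁ * θ) * (exp A - exp A₀)
        + g₀ * (exp A - exp A₀ - exp A₀ * (A - A₀)) + g₀ * exp A₀ * (t * R) := by
    rw [hD]; ring
  have n1 : ‖(q - g₀ - I * g₁ * θ) * exp A‖ ≤ M * θ ^ 2 * E := by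
    rw [norm_mul]; gcongr
  have n2 : ‖(I * g₁ * θ) * (exp A - exp A₀)‖ ≤ M * |θ| * (E * (5 * M * t * |θ| ^ 3)) := by
    rw [norm_mul, norm_mul, norm_mul, norm_I, one_mul]
    simp only [norm_real, Real.norm_eq_abs]
    refine mul_le_mul (by gcongr) (b1.trans (by gcongr)) (norm_nonneg _) (by positivity)
  have n3 : ‖g₀ * (exp A - exp A₀ - exp A₀ * (A - A₀))‖ ≤
      M * (E * (5 * M * t * |θ| ^ 3) ^ 2) := by
    rw [norm_mul]
    simp only [norm_real, Real.norm_eq_abs]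
    refine mul_le_mul hg₀ (b2.trans (by gcongr)) (norm_nonneg _) hM
  have n4 : ‖g₀ * exp A₀ * (t * R)‖ ≤ M * E * (t * (M * θ ^ 4)) := by
    rw [norm_mul, norm_mul, norm_mul]
    simp only [norm_real, Real.norm_eq_abs, abs_of_pos ht]
    gcongr
  rw [dec]
  calc _ ≤ M * θ ^ 2 * E + M * |θ| * (E * (5 * M * t * |θ| ^ 3)) +
        M * (E * (5 * M * t * |θ| ^ 3) ^ 2) + M * E * (t * (M * θ ^ 4)) := by
        refine (norm_add_le _ _).trans (add_le_add ((norm_add_le _ _).trans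
          (add_le_add ((norm_add_le _ _).trans (add_le_add n1 n2)) n3)) n4)
    _ = (M * u + 6 * M ^ 2 * u ^ 2 + 25 * M ^ 3 * u ^ 3) * E / t := by
        rw [hu, hθ4, hθ2]
        field_simp
        ring
    _ ≤ laplaceConst κ M * Real.exp (-(κ / 2) * u) / t := by
        have := cubic_mul_exp_le hκ hM hu0
        gcongr
    _ = _ := by
        rw [hu, show -(κ / 2) * (t * θ ^ 2) = -(κ / 2 * t) * θ ^ 2 by ring]
        ring

theorem integral_odd_eq_zero {f : ℝ → ℂ} (hf : ∀ x, f (-x) = -f x) (a : ℝ) :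
    ∫ x in (-a)..a, f x = 0 := by
  have h := intervalIntegral.integral_comp_neg f (a := -a) (b := a)
  simp only [hf, neg_neg, intervalIntegral.integral_neg] at h
  exact self_eq_neg.mp h.symm

/-- Laplace's method with a uniform error: the integral over the circle is the Gaussian integral
up to a relative error `O(1/t)`, because the cubic term of the phase and the linear term of the
prefactor contribute odd functions. -/
theorem norm_laplace_integral_sub_le {κ M v c g₀ g₁ t : ℝ} {φ g : ℝ → ℂ} (hκ : 0 < κ)
    (hM : 0 ≤ M) (hv : 2 * κ ≤ v) (hc : |c| ≤ M) (hg₀ : |g₀| ≤ M) (hg₁ : |g₁| ≤ M)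
    (ht : 0 < t) (hφc : Continuous φ) (hgc : Continuous g)
    (hφ : ∀ θ : ℝ, ‖φ θ + v * θ ^ 2 / 2 - I * c * θ ^ 3‖ ≤ M * θ ^ 4)
    (hre : ∀ θ : ℝ, |θ| ≤ Real.pi → (φ θ).re ≤ -κ * θ ^ 2)
    (hg : ∀ θ : ℝ, ‖g θ - g₀ - I * g₁ * θ‖ ≤ M * θ ^ 2) :
    ‖(∫ θ in (-Real.pi)..Real.pi, g θ * exp (t * φ θ)) - (g₀ * √(2 * Real.pi / (t * v)) : ℝ)‖ ≤
      laplaceConst κ M * √(2 * Real.pi / κ) / (t * √t) := by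
  have hpi := Real.pi_pos
  have hv0 : 0 < v := by linarith
  have hle : -Real.pi ≤ Real.pi := by linarith
  set b := t * v / 2 with hb
  have hb0 : 0 < b := by positivity
  set odd : ℝ → ℂ := fun θ => exp (-(b : ℝ) * θ ^ 2) * (I * (g₁ * θ + g₀ * c * t * θ ^ 3))
    with hodd
  set f : ℝ → ℂ := fun θ => g θ * exp (t * φ θ) - odd θ with hf
  have hoddc : Continuous odd := by fun_prop
  have hmainc : Continuous fun θ => g θ * exp (t * φ θ) := by fun_prop
  have hfc : Continuous f := hmainc.sub hoddc
  have hfint : ∫ θ in (-Real.pi)..Real.pi, f θ =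
      ∫ θ in (-Real.pi)..Real.pi, g θ * exp (t * φ θ) := by
    have h0 : ∫ θ in (-Real.pi)..Real.pi, odd θ = 0 := by
      refine integral_odd_eq_zero (fun x => ?_) Real.pi
      simp only [hodd]
      push_cast
      ring_nf
    rw [hf, intervalIntegral.integral_sub (hmainc.intervalIntegrable _ _)
      (hoddc.intervalIntegrable _ _), h0, sub_zero]
  set G : ℝ → ℂ := fun θ => g₀ * exp (-(b : ℝ) * θ ^ 2) with hG
  have hGr : ∀ θ, G θ = ((g₀ * Real.exp (-b * θ ^ 2) : ℝ) : ℂ) := by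
    intro θ; simp only [hG]; push_cast; ring
  have hGi : Integrable G := by
    simp only [funext hGr]
    exact ((integrable_exp_neg_mul_sq hb0).const_mul g₀).ofReal
  have hGint : ∫ θ, G θ = (g₀ * √(2 * Real.pi / (t * v)) : ℝ) := by
    simp only [hGr]
    rw [integral_complex_ofReal, integral_const_mul, integral_gaussian]
    congr 3
    rw [hb]; field_simp
  set S := Set.Ioc (-Real.pi) Real.pi with hS
  have hfi : Integrable (S.indicator f) := by
    rw [integrable_indicator_iff measurableSet_Ioc]
    exact (intervalIntegrable_iff_integrableOn_Ioc_of_le hle).mp (hfc.intervalIntegrable _ _)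
  have hκt : 0 < κ / 2 * t := by positivity
  have hbound : ∀ θ, ‖S.indicator f θ - G θ‖ ≤
      laplaceConst κ M / t * Real.exp (-(κ / 2 * t) * θ ^ 2) := by
    intro θ
    by_cases hθ : θ ∈ S
    · have habs : |θ| ≤ Real.pi := abs_le.mpr ⟨hθ.1.le, hθ.2⟩
      rw [Set.indicator_of_mem hθ]
      exact norm_laplace_integrand_sub_le hκ hM hv hc hg₀ hg₁ (habs.trans Real.pi_le_four) ht
        (hφ θ) (hre θ habs) (hg θ)
    · -- outside the circle `1 ≤ θ ^ 2`, so that the Gaussian tail is bounded in the same way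
      have h1 : 1 ≤ θ ^ 2 := by
        by_contra hlt
        push Not at hlt
        have := abs_lt.mp ((sq_lt_one_iff_abs_lt_one θ).mp hlt)
        have := Real.pi_gt_three
        exact hθ ⟨by linarith, by linarith⟩
      rw [Set.indicator_of_notMem hθ, zero_sub, norm_neg, hGr, norm_real, Real.norm_eq_abs,
        abs_mul, abs_of_pos (Real.exp_pos _)]
      have hu0 : 0 ≤ t * θ ^ 2 := by positivity
      have h2 := cubic_mul_exp_le hκ hM hu0
      have h3 : Real.exp (-b * θ ^ 2) ≤ Real.exp (-(κ * (t * θ ^ 2))) := by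
        apply Real.exp_le_exp.mpr
        rw [hb]
        nlinarith
      calc |g₀| * Real.exp (-b * θ ^ 2) ≤ M * 1 * Real.exp (-(κ * (t * θ ^ 2))) := by
            rw [mul_one]; gcongr
        _ ≤ M * θ ^ 2 * Real.exp (-(κ * (t * θ ^ 2))) := by gcongr
        _ = (M * (t * θ ^ 2)) * Real.exp (-(κ * (t * θ ^ 2))) / t := by field_simp
        _ ≤ (M * (t * θ ^ 2) + 6 * M ^ 2 * (t * θ ^ 2) ^ 2 + 25 * M ^ 3 * (t * θ ^ 2) ^ 3) *
              Real.exp (-(κ * (t * θ ^ 2))) / t := by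
            gcongr
            have : 0 ≤ 6 * M ^ 2 * (t * θ ^ 2) ^ 2 + 25 * M ^ 3 * (t * θ ^ 2) ^ 3 := by positivity
            linarith
        _ ≤ laplaceConst κ M * Real.exp (-(κ / 2) * (t * θ ^ 2)) / t := by gcongr
        _ = _ := by
            rw [show -(κ / 2) * (t * θ ^ 2) = -(κ / 2 * t) * θ ^ 2 by ring]; ring
  have hI := norm_integral_le_of_norm_le
    ((integrable_exp_neg_mul_sq hκt).const_mul (laplaceConst κ M / t))
    (Filter.Eventually.of_forall hbound)
  rw [integral_sub hfi hGi, integral_indicator measurableSet_Ioc, hGint,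
    ← intervalIntegral.integral_of_le hle, hfint, integral_const_mul, integral_gaussian] at hI
  refine hI.trans_eq ?_
  rw [show Real.pi / (κ / 2 * t) = 2 * Real.pi / κ / t by field_simp,
    Real.sqrt_div' _ ht.le]
  field_simp

end HadamardWalk

/-! ### The saddle point and the phase -/

namespace HadamardWalk

open Complex

/-- The root `s = √(2α² - 1)` of the discriminant of the saddle point equation. -/
noncomputable def disc (α : ℝ) : ℝ := √(2 * α ^ 2 - 1)

/-- The smaller of the two saddle points `(α ± s) / (1 + α)` on the positive real axis, where the
modulus of the integrand has its minimum along the axis and its maximum along the circle. -/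
noncomputable def saddle (α : ℝ) : ℝ := (α - disc α) / (1 + α)

theorem inv_sqrt_two_sq : (1 / √2) ^ 2 = (1 / 2 : ℝ) := by
  rw [div_pow, Real.sq_sqrt (by norm_num)]; norm_num

theorem inv_sqrt_two_pos : 0 < (1 / √2 : ℝ) := by positivity

theorem disc_sq {α : ℝ} (h1 : 1 / √2 < α) : disc α ^ 2 = 2 * α ^ 2 - 1 := by
  have := inv_sqrt_two_sq
  have := inv_sqrt_two_pos
  exact Real.sq_sqrt (by nlinarith)

theorem disc_pos {α : ℝ} (h1 : 1 / √2 < α) : 0 < disc α := by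
  have := inv_sqrt_two_sq
  have := inv_sqrt_two_pos
  exact Real.sqrt_pos.mpr (by nlinarith)

theorem disc_lt {α : ℝ} (h1 : 1 / √2 < α) (h2 : α < 1) : disc α < α := by
  have := disc_sq h1
  have := inv_sqrt_two_pos
  nlinarith [disc_pos h1]

theorem saddle_mul {α : ℝ} (h1 : 1 / √2 < α) : saddle α * (1 + α) = α - disc α := by
  have := inv_sqrt_two_pos
  rw [saddle, div_mul_cancel₀ _ (by linarith)]

theorem saddle_pos {α : ℝ} (h1 : 1 / √2 < α) (h2 : α < 1) : 0 < saddle α := by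
  have := inv_sqrt_two_pos
  have := disc_lt h1 h2
  exact div_pos (by linarith) (by linarith)

theorem saddle_quadratic {α : ℝ} (h1 : 1 / √2 < α) :
    (1 + α) * saddle α ^ 2 - 2 * α * saddle α + (1 - α) = 0 := by
  have := inv_sqrt_two_pos
  have hz := saddle_mul h1
  have hs := disc_sq h1
  have h0 : (1 + α) ≠ 0 := by linarith
  refine mul_left_cancel₀ h0 ?_
  linear_combination (saddle α * (1 + α) - α - disc α) * hz + hs

/-- The rational parametrisation of the speed by the saddle point. -/
theorem speed_eq_saddle {α : ℝ} (h1 : 1 / √2 < α) :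
    α * (1 + 2 * saddle α - saddle α ^ 2) = 1 + saddle α ^ 2 := by
  linear_combination -saddle_quadratic h1

/-- The rational parametrisation of the discriminant root by the saddle point. -/
theorem disc_eq_saddle {α : ℝ} (h1 : 1 / √2 < α) :
    disc α * (1 + 2 * saddle α - saddle α ^ 2) = 1 - 2 * saddle α - saddle α ^ 2 := by
  have h := speed_eq_saddle h1
  have hz := saddle_mul h1
  linear_combination (1 - saddle α) * h + (1 + 2 * saddle α - saddle α ^ 2) * hz

theorem saddle_lt {α : ℝ} (h1 : 1 / √2 < α) (h2 : α < 1) : saddle α < √2 - 1 := by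
  have hp := inv_sqrt_two_pos
  have hz := saddle_pos h1 h2
  have hd := disc_pos h1
  have hm := saddle_mul h1
  have hlt : saddle α < 1 := by nlinarith
  have hD : 0 < 1 + 2 * saddle α - saddle α ^ 2 := by nlinarith
  have h3 := disc_eq_saddle h1
  have h4 := mul_pos hd hD
  have h5 : 1 + saddle α < √2 := Real.lt_sqrt_of_sq_lt (by nlinarith)
  linarith

theorem sqrt_two_lt : √2 < (3 / 2 : ℝ) := by
  rw [Real.sqrt_lt' (by norm_num)]; norm_num

theorem saddle_lt_half {α : ℝ} (h1 : 1 / √2 < α) (h2 : α < 1) : saddle α < 1 / 2 := by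
  linarith [saddle_lt h1 h2, sqrt_two_lt]

/-- Minus the second derivative of the phase with respect to the angle at the saddle point. -/
noncomputable def curvature (α : ℝ) : ℝ := disc α * saddle α / (1 - saddle α ^ 2)

/-- The saddle point equation, as the vanishing of the linear term of the phase. -/
theorem phase_linear_coeff {α ζ : ℝ} (hz : 0 < ζ) (hz2 : ζ < 1)
    (hα : α * (1 + 2 * ζ - ζ ^ 2) = 1 + ζ ^ 2) :
    (1 - α) / 2 * (1 - (1 + -ζ)⁻¹) + (1 + α) / 2 * (1 - (1 + ζ)⁻¹) - (1 - α) / 2 = 0 := by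
  have h1 : 1 + -ζ ≠ 0 := by linarith
  have h2 : 1 + ζ ≠ 0 := by linarith
  field_simp
  linear_combination hα

/-- The quadratic term of the phase: `ξ / (1 + ξ) ^ 2` is minus the second derivative of
`log (1 + ξ e^{iθ})` at `θ = 0`. -/
theorem phase_quadratic_coeff {α ζ s : ℝ} (hz : 0 < ζ) (hz2 : ζ < 1)
    (hα : α * (1 + 2 * ζ - ζ ^ 2) = 1 + ζ ^ 2) (hs : ζ * (1 + α) = α - s) :
    (1 - α) / 2 * (ζ / (1 - ζ) ^ 2) - (1 + α) / 2 * (ζ / (1 + ζ) ^ 2) =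
      -(s * ζ / (1 - ζ ^ 2)) := by
  have h1 : 1 - ζ ≠ 0 := by linarith
  have h2 : 1 + ζ ≠ 0 := by linarith
  obtain rfl : s = α - ζ * (1 + α) := by linarith
  rw [show 1 - ζ ^ 2 = (1 - ζ) * (1 + ζ) by ring]
  field_simp
  linear_combination (-2 * ζ) * hα

/-- The phase on the circle through the saddle point, normalised to vanish there: for `l` moves to
the left and `r` moves to the right, `exp ((l + r) * phase α θ)` is the value of
`(1 - z) ^ l * (1 + z) ^ r / z ^ l` at `z = saddle α * e^{iθ}` relative to that at the saddle
point. -/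
noncomputable def phase (α θ : ℝ) : ℂ :=
  (1 - α) / 2 * (log (1 + ((-saddle α : ℝ) : ℂ) * exp (θ * I)) - log (1 + ((-saddle α : ℝ) : ℂ))) +
    (1 + α) / 2 * (log (1 + (saddle α : ℂ) * exp (θ * I)) - log (1 + (saddle α : ℂ))) -
    (1 - α) / 2 * (I * θ)

/-- The coefficient of `i θ³` in the expansion of `log (1 + ξ e^{iθ})` at `θ = 0`. -/
noncomputable def logCubic (ξ : ℝ) : ℝ :=
  (1 - 2 * (1 + ξ)⁻¹) * ((1 + ξ)⁻¹ - (1 + ξ)⁻¹ ^ 2) / 6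

theorem abs_inv_one_add_le {ξ : ℝ} (hξ : |ξ| ≤ 1 / 2) : |(1 + ξ)⁻¹| ≤ 2 := by
  have := norm_circInv_le hξ 0
  rwa [circInv_zero, norm_real, Real.norm_eq_abs] at this

theorem abs_logCubic_le {ξ : ℝ} (hξ : |ξ| ≤ 1 / 2) : |logCubic ξ| ≤ 5 := by
  have h := abs_inv_one_add_le hξ
  rw [logCubic, abs_div, abs_mul]
  set u := (1 + ξ)⁻¹
  have h' := abs_le.mp h
  have h1 : |1 - 2 * u| ≤ 5 := abs_le.mpr ⟨by linarith, by linarith⟩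
  have h2 : |u - u ^ 2| ≤ 6 := abs_le.mpr ⟨by nlinarith, by nlinarith⟩
  rw [abs_of_pos (by norm_num : (0 : ℝ) < 6), div_le_iff₀ (by norm_num)]
  calc _ ≤ (5 : ℝ) * 6 := by gcongr
    _ = _ := by norm_num

/-- Third order expansion of the phase. The linear term vanishes by the saddle point equation and
the cubic coefficient is purely imaginary. -/
theorem norm_phase_sub_le {α : ℝ} (h1 : 1 / √2 < α) (h2 : α < 1) (θ : ℝ) :
    ‖phase α θ + curvature α * θ ^ 2 / 2 -
        I * ((1 - α) / 2 * logCubic (-saddle α) + (1 + α) / 2 * logCubic (saddle α) : ℝ) * θ ^ 3‖ ≤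
      222 * θ ^ 4 := by
  have hp := inv_sqrt_two_pos
  have hz := saddle_pos h1 h2
  have hz2 := saddle_lt_half h1 h2
  have hb : |saddle α| ≤ 1 / 2 := by rw [abs_of_pos hz]; exact hz2.le
  have hb' : |-saddle α| ≤ 1 / 2 := by rwa [abs_neg]
  have e1 := norm_log_one_add_sub_le hb' θ
  have e2 := norm_log_one_add_sub_le hb θ
  rw [circInv_zero] at e1 e2
  have lin := phase_linear_coeff hz (by linarith) (speed_eq_saddle h1)
  have quad := phase_quadratic_coeff hz (by linarith) (speed_eq_saddle h1) (saddle_mul h1)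
  change _ = -curvature α at quad
  have q1 : (1 + -saddle α)⁻¹ - (1 + -saddle α)⁻¹ ^ 2 = -(saddle α / (1 - saddle α) ^ 2) := by
    have : 1 - saddle α ≠ 0 := by linarith
    rw [← sub_eq_add_neg]; field_simp; ring
  have q2 : (1 + saddle α)⁻¹ - (1 + saddle α)⁻¹ ^ 2 = saddle α / (1 + saddle α) ^ 2 := by
    have : 1 + saddle α ≠ 0 := by linarith
    field_simp; ring
  rw [← neg_eq_iff_eq_neg.mpr q1, ← q2] at quad
  simp only [logCubic]
  set u := (1 + -saddle α)⁻¹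
  set w := (1 + saddle α)⁻¹
  have linC : (1 - (α : ℂ)) / 2 * (1 - u) + (1 + α) / 2 * (1 - w) - (1 - α) / 2 = 0 := by
    exact_mod_cast congrArg ((↑) : ℝ → ℂ) lin
  have quadC : (1 - (α : ℂ)) / 2 * (-(u - u ^ 2)) - (1 + α) / 2 * (w - w ^ 2) =
      -(curvature α : ℂ) := by
    exact_mod_cast congrArg ((↑) : ℝ → ℂ) quad
  set R1 := log (1 + ((-saddle α : ℝ) : ℂ) * exp (θ * I)) - log (1 + ((-saddle α : ℝ) : ℂ))
    - I * (1 - u) * θ + (u - u ^ 2) * θ ^ 2 / 2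
    - I * (1 - 2 * u) * (u - u ^ 2) * θ ^ 3 / 6 with hR1
  set R2 := log (1 + (saddle α : ℂ) * exp (θ * I)) - log (1 + (saddle α : ℂ))
    - I * (1 - w) * θ + (w - w ^ 2) * θ ^ 2 / 2
    - I * (1 - 2 * w) * (w - w ^ 2) * θ ^ 3 / 6 with hR2
  have dec : phase α θ + curvature α * θ ^ 2 / 2 -
        I * ((1 - α) / 2 * ((1 - 2 * u) * (u - u ^ 2) / 6) +
          (1 + α) / 2 * ((1 - 2 * w) * (w - w ^ 2) / 6) : ℝ) * θ ^ 3 =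
      ((1 - α) / 2 : ℝ) * R1 + ((1 + α) / 2 : ℝ) * R2 := by
    rw [phase, hR1, hR2]
    push_cast
    linear_combination (I * θ) * linC + (θ ^ 2 / 2 : ℂ) * quadC
  rw [dec]
  refine (norm_add_le _ _).trans ?_
  rw [norm_mul, norm_mul, norm_real, norm_real, Real.norm_eq_abs, Real.norm_eq_abs,
    abs_of_pos (by linarith : 0 < (1 - α) / 2), abs_of_pos (by linarith : 0 < (1 + α) / 2)]
  calc _ ≤ (1 - α) / 2 * (222 * θ ^ 4) + (1 + α) / 2 * (222 * θ ^ 4) := by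
        have : 0 ≤ 1 - α := by linarith
        have : 0 ≤ 1 + α := by linarith
        gcongr
    _ = _ := by ring

/-- A global bound that agrees with the expansion at `θ = 0` to second order, from
`log x ≤ x - 1`. -/
theorem re_log_one_add_sub_le {ξ : ℝ} (hξ : |ξ| ≤ 1 / 2) (θ : ℝ) :
    (log (1 + (ξ : ℂ) * exp (θ * I)) - log (1 + (ξ : ℂ))).re ≤
      -(ξ / (1 + ξ) ^ 2 * (1 - Real.cos θ)) := by
  have h' := abs_le.mp hξ
  have hpos : 0 < 1 + ξ := by linarith
  set N := ‖1 + (ξ : ℂ) * exp (θ * I)‖ with hN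
  have hN0 : 0 < N := norm_pos_iff.mpr (slitPlane_ne_zero (one_add_mem_slitPlane hξ θ))
  have hNsq : N ^ 2 = (1 + ξ) ^ 2 - 2 * ξ * (1 - Real.cos θ) := by
    rw [hN, Complex.sq_norm, normSq_apply]
    simp [exp_ofReal_mul_I_re, exp_ofReal_mul_I_im]
    linear_combination ξ ^ 2 * Real.sin_sq_add_cos_sq θ
  have hone : ‖(1 : ℂ) + (ξ : ℂ)‖ = 1 + ξ := by
    rw [← ofReal_one, ← ofReal_add, norm_real, Real.norm_eq_abs, abs_of_pos hpos]
  rw [sub_re, log_re, log_re, hone, ← hN, ← Real.log_div hN0.ne' hpos.ne']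
  have h2 := Real.log_le_sub_one_of_pos (x := (N / (1 + ξ)) ^ 2) (by positivity)
  rw [Real.log_pow, div_pow, hNsq, sub_div, div_self (by positivity)] at h2
  push_cast at h2
  have : ξ / (1 + ξ) ^ 2 * (1 - Real.cos θ) = 2 * ξ * (1 - Real.cos θ) / (1 + ξ) ^ 2 / 2 := by
    ring
  linarith

/-- On the whole circle the modulus decays at least like a Gaussian away from the saddle point. -/
theorem re_phase_le {α : ℝ} (h1 : 1 / √2 < α) (h2 : α < 1) {θ : ℝ} (hθ : |θ| ≤ Real.pi) :
    (phase α θ).re ≤ -(curvature α / 5) * θ ^ 2 := by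
  have hp := inv_sqrt_two_pos
  have hz := saddle_pos h1 h2
  have hz2 := saddle_lt_half h1 h2
  have hb : |saddle α| ≤ 1 / 2 := by rw [abs_of_pos hz]; exact hz2.le
  have hb' : |-saddle α| ≤ 1 / 2 := by rwa [abs_neg]
  have e1 := re_log_one_add_sub_le hb' θ
  have e2 := re_log_one_add_sub_le hb θ
  have quad := phase_quadratic_coeff hz (by linarith) (speed_eq_saddle h1) (saddle_mul h1)
  change _ = -curvature α at quad
  have hv : 0 < curvature α :=
    div_pos (mul_pos (disc_pos h1) hz) (by nlinarith)
  have hre : (phase α θ).re =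
      (1 - α) / 2 * (log (1 + ((-saddle α : ℝ) : ℂ) * exp (θ * I)) -
        log (1 + ((-saddle α : ℝ) : ℂ))).re +
      (1 + α) / 2 * (log (1 + (saddle α : ℂ) * exp (θ * I)) - log (1 + (saddle α : ℂ))).re := by
    have c1 : (1 - (α : ℂ)) / 2 = (((1 - α) / 2 : ℝ) : ℂ) := by push_cast; ring
    have c2 : (1 + (α : ℂ)) / 2 = (((1 + α) / 2 : ℝ) : ℂ) := by push_cast; ring
    rw [phase, c1, c2, sub_re, add_re, re_ofReal_mul, re_ofReal_mul, re_ofReal_mul]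
    simp
  have hcos := Real.cos_le_one_sub_mul_cos_sq hθ
  have hpi : 2 / Real.pi ^ 2 ≥ 1 / 5 := by
    have := Real.pi_lt_d2
    have := Real.pi_pos
    rw [ge_iff_le, div_le_div_iff₀ (by norm_num) (by positivity)]
    nlinarith
  have hcos2 : 1 / 5 * θ ^ 2 ≤ 1 - Real.cos θ := by nlinarith [sq_nonneg θ]
  rw [hre]
  calc _ ≤ (1 - α) / 2 * (-(-saddle α / (1 + -saddle α) ^ 2 * (1 - Real.cos θ))) +
        (1 + α) / 2 * (-(saddle α / (1 + saddle α) ^ 2 * (1 - Real.cos θ))) := by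
        have : 0 ≤ (1 - α) / 2 := by linarith
        have : 0 ≤ (1 + α) / 2 := by linarith
        gcongr
    _ = -curvature α * (1 - Real.cos θ) := by rw [← quad]; ring
    _ ≤ -curvature α * (1 / 5 * θ ^ 2) := by
        rw [neg_mul, neg_mul]; gcongr
    _ = _ := by ring

theorem continuous_phase {α : ℝ} (h1 : 1 / √2 < α) (h2 : α < 1) : Continuous (phase α) := by
  have hz := saddle_pos h1 h2
  have hz2 := saddle_lt_half h1 h2
  have hb : |saddle α| ≤ 1 / 2 := by rw [abs_of_pos hz]; exact hz2.le
  have hb' : |-saddle α| ≤ 1 / 2 := by rwa [abs_neg]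
  have c1 : Continuous fun θ : ℝ => log (1 + ((-saddle α : ℝ) : ℂ) * exp (θ * I)) :=
    continuous_iff_continuousAt.mpr fun θ => (hasDerivAt_log_one_add hb' θ).continuousAt
  have c2 : Continuous fun θ : ℝ => log (1 + (saddle α : ℂ) * exp (θ * I)) :=
    continuous_iff_continuousAt.mpr fun θ => (hasDerivAt_log_one_add hb θ).continuousAt
  unfold phase
  fun_prop

theorem continuous_circInv {ξ : ℝ} (hξ : |ξ| ≤ 1 / 2) : Continuous (circInv ξ) :=
  continuous_iff_continuousAt.mpr fun θ => (hasDerivAt_circInv hξ θ).continuousAt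

theorem exp_mul_log_sub_log {a b : ℂ} (ha : a ≠ 0) (hb : b ≠ 0) (n : ℕ) :
    exp (n * (log a - log b)) = a ^ n / b ^ n := by
  rw [exp_nat_mul, exp_sub, exp_log ha, exp_log hb, div_pow]

/-- The value of `(1 - z) ^ l * (1 + z) ^ r / z ^ l` at `z = ζ`. -/
noncomputable def saddleValue (ζ : ℝ) (l r : ℕ) : ℝ := (1 - ζ) ^ l * (1 + ζ) ^ r / ζ ^ l

theorem integrand_eq_exp_phase {α : ℝ} (h1 : 1 / √2 < α) (h2 : α < 1) {l r : ℕ}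
    (ht : 0 < l + r) (hα : α = ((r : ℝ) - l) / (l + r : ℕ)) (θ : ℝ) :
    (1 - saddle α * exp (θ * I)) ^ l * (1 + saddle α * exp (θ * I)) ^ r /
        (saddle α * exp (θ * I)) ^ l =
      saddleValue (saddle α) l r * exp (((l + r : ℕ) : ℝ) * phase α θ) := by
  have hz := saddle_pos h1 h2
  have hz2 := saddle_lt_half h1 h2
  have hb : |saddle α| ≤ 1 / 2 := by rw [abs_of_pos hz]; exact hz2.le
  have hb' : |-saddle α| ≤ 1 / 2 := by rwa [abs_neg]
  have ht' : ((l + r : ℕ) : ℝ) ≠ 0 := by exact_mod_cast ht.ne'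
  have hα' : α * ((l : ℝ) + r) = r - l := by
    rw [hα]; push_cast; push_cast at ht'; field_simp
  have hl : ((l + r : ℕ) : ℂ) * ((1 - α) / 2) = l := by
    have : ((l + r : ℕ) : ℝ) * ((1 - α) / 2) = l := by push_cast; linarith
    exact_mod_cast congrArg ((↑) : ℝ → ℂ) this
  have hr : ((l + r : ℕ) : ℂ) * ((1 + α) / 2) = r := by
    have : ((l + r : ℕ) : ℝ) * ((1 + α) / 2) = r := by push_cast; linarith
    exact_mod_cast congrArg ((↑) : ℝ → ℂ) this
  have n1 := slitPlane_ne_zero (one_add_mem_slitPlane hb' θ)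
  have n2 := slitPlane_ne_zero (one_add_mem_slitPlane hb θ)
  have n3 : (1 : ℂ) + ((-saddle α : ℝ) : ℂ) ≠ 0 := by
    rw [← ofReal_one, ← ofReal_add]; exact_mod_cast (by linarith : 1 + -saddle α ≠ 0)
  have n4 : (1 : ℂ) + (saddle α : ℂ) ≠ 0 := by
    rw [← ofReal_one, ← ofReal_add]; exact_mod_cast (by linarith : 1 + saddle α ≠ 0)
  have n5 : (saddle α : ℂ) ≠ 0 := by exact_mod_cast hz.ne'
  have hexp : (((l + r : ℕ) : ℝ) : ℂ) * phase α θ =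
      l * (log (1 + ((-saddle α : ℝ) : ℂ) * exp (θ * I)) - log (1 + ((-saddle α : ℝ) : ℂ))) +
      r * (log (1 + (saddle α : ℂ) * exp (θ * I)) - log (1 + (saddle α : ℂ))) -
      l * (θ * I) := by
    rw [ofReal_natCast, phase, ← hl, ← hr]; ring
  rw [hexp, exp_sub, exp_add, exp_mul_log_sub_log n1 n3, exp_mul_log_sub_log n2 n4, exp_nat_mul,
    saddleValue]
  have m1 := pow_ne_zero l n3
  have m2 := pow_ne_zero r n4
  push_cast at m1 ⊢
  rw [← sub_eq_add_neg] at m1 ⊢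
  rw [neg_mul, ← sub_eq_add_neg, mul_pow]
  have m3 : exp (θ * I) ^ l ≠ 0 := pow_ne_zero _ (exp_ne_zero _)
  have m4 := pow_ne_zero l n5
  field_simp

end HadamardWalk

/-! ### The base of the decay and the asymptotics of coefficients -/

namespace HadamardWalk

open Complex Polynomial

theorem disc_ge {α ε : ℝ} (hε : 0 < ε) (h : 1 / √2 + ε ≤ α) : ε ≤ disc α := by
  have hp := inv_sqrt_two_pos
  have hq := inv_sqrt_two_sq
  refine Real.le_sqrt_of_sq_le ?_
  nlinarith

theorem saddle_ge {α ε : ℝ} (hε : 0 < ε) (h : α ∈ Set.Icc (1 / √2 + ε) (1 - ε)) :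
    ε / 2 ≤ saddle α := by
  have h1 : 1 / √2 < α := by linarith [h.1]
  have h2 : α < 1 := by linarith [h.2]
  have hp := inv_sqrt_two_pos
  have hm := saddle_mul h1
  have hs := disc_sq h1
  have hd := disc_lt h1 h2
  have hz := saddle_pos h1 h2
  have key : saddle α * (α + disc α) = 1 - α := by
    refine mul_left_cancel₀ (by linarith : 1 + α ≠ 0) ?_
    linear_combination (α + disc α) * hm - hs
  have := h.2
  nlinarith

theorem curvature_le_one {α : ℝ} (h1 : 1 / √2 < α) (h2 : α < 1) : curvature α ≤ 1 := by
  have hz := saddle_pos h1 h2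
  have hz2 := saddle_lt_half h1 h2
  have hd := disc_lt h1 h2
  have hd0 := disc_pos h1
  rw [curvature, div_le_one (by nlinarith)]
  nlinarith

theorem curvature_ge {α ε : ℝ} (hε : 0 < ε) (h : α ∈ Set.Icc (1 / √2 + ε) (1 - ε)) :
    ε ^ 2 / 2 ≤ curvature α := by
  have h1 : 1 / √2 < α := by linarith [h.1]
  have h2 : α < 1 := by linarith [h.2]
  have hz := saddle_ge hε h
  have hz2 := saddle_lt_half h1 h2
  have hd := disc_ge hε h.1
  have hp : 0 < saddle α := saddle_pos h1 h2
  rw [curvature, le_div_iff₀ (by nlinarith)]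
  have h3 : ε * (ε / 2) ≤ disc α * saddle α :=
    mul_le_mul hd hz (by positivity) (hε.le.trans hd)
  have h4 : 0 ≤ ε ^ 2 / 2 * saddle α ^ 2 := by positivity
  nlinarith

/-- The base of the decay expressed by the saddle point. -/
theorem B_eq {α : ℝ} (h1 : 1 / √2 < α) (h2 : α < 1) :
    B α = (2 : ℝ) ^ (-α / 2) * (1 + saddle α) ^ α *
      ((1 - saddle α ^ 2) / (2 * saddle α)) ^ ((1 - α) / 2) := by
  have hp := inv_sqrt_two_pos
  have hm := saddle_mul h1
  have hs := disc_sq h1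
  have hz := saddle_pos h1 h2
  have e1 : (1 + 2 * α - √(2 * α ^ 2 - 1)) / (1 + α) = 1 + saddle α := by
    rw [div_eq_iff (by linarith)]
    rw [disc] at hm
    linarith
  have e2 : (α ^ 2 + √(2 * α ^ 2 - 1)) / (1 - α ^ 2) =
      (1 - saddle α ^ 2) / (2 * saddle α) := by
    change (α ^ 2 + disc α) / (1 - α ^ 2) = _
    rw [div_eq_div_iff (by nlinarith) (by positivity)]
    refine mul_left_cancel₀ (pow_ne_zero 2 (by linarith : 1 + α ≠ 0)) ?_
    linear_combination (2 * (α ^ 2 + disc α) * (1 + α) +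
      (1 - α ^ 2) * (saddle α * (1 + α) + (α - disc α))) * hm - (1 + α) ^ 2 * hs
  rw [B, e1, e2]

theorem B_pos {α : ℝ} (h1 : 1 / √2 < α) (h2 : α < 1) : 0 < B α := by
  have hz := saddle_pos h1 h2
  have hz2 := saddle_lt_half h1 h2
  have : 0 < (1 - saddle α ^ 2) / (2 * saddle α) := div_pos (by nlinarith) (by positivity)
  rw [B_eq h1 h2]
  positivity

/-- The power of the base is the saddle point value of the integrand, with the normalisation
`2^{-t/2}` of the coin included. -/
theorem B_pow {α : ℝ} (h1 : 1 / √2 < α) (h2 : α < 1) {l r : ℕ}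
    (ht : 0 < l + r) (hα : α = ((r : ℝ) - l) / (l + r : ℕ)) :
    B α ^ (l + r) = saddleValue (saddle α) l r / √2 ^ (l + r) := by
  have hz := saddle_pos h1 h2
  have hz2 := saddle_lt_half h1 h2
  have ht' : ((l + r : ℕ) : ℝ) ≠ 0 := by exact_mod_cast ht.ne'
  have hα' : α * ((l + r : ℕ) : ℝ) = r - l := by
    rw [hα]; field_simp
  have hb : 0 < (1 - saddle α ^ 2) / (2 * saddle α) := div_pos (by nlinarith) (by positivity)
  have e1 : ((2 : ℝ) ^ (-α / 2)) ^ (l + r) = √2 ^ l / √2 ^ r := by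
    rw [← Real.rpow_mul_natCast (by norm_num), Real.sqrt_eq_rpow,
      ← Real.rpow_mul_natCast (by norm_num), ← Real.rpow_mul_natCast (by norm_num),
      ← Real.rpow_sub (by norm_num)]
    congr 1
    linear_combination (-1 / 2) * hα'
  have e2 : ((1 + saddle α) ^ α) ^ (l + r) = (1 + saddle α) ^ r / (1 + saddle α) ^ l := by
    rw [← Real.rpow_mul_natCast (by linarith), hα', Real.rpow_sub (by linarith),
      Real.rpow_natCast, Real.rpow_natCast]
  have e3 : (((1 - saddle α ^ 2) / (2 * saddle α)) ^ ((1 - α) / 2)) ^ (l + r) =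
      ((1 - saddle α) * (1 + saddle α) / (√2 * √2 * saddle α)) ^ l := by
    rw [← Real.rpow_mul_natCast hb.le, show (1 - α) / 2 * ((l + r : ℕ) : ℝ) = l by
      push_cast at hα' ⊢; linarith, Real.rpow_natCast, Real.mul_self_sqrt (by norm_num)]
    congr 2
    ring
  rw [B_eq h1 h2, mul_pow, mul_pow, e1, e2, e3, saddleValue]
  have : 1 + saddle α ≠ 0 := by linarith
  rw [div_pow, mul_pow, mul_pow, mul_pow]
  field_simp
  ring

/-- The logarithm of the modulus of the integrand at the real point `x`, normalised to
`l = 1 - α` and `r = 1 + α`. -/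
noncomputable def logModulus (α x : ℝ) : ℝ :=
  (1 - α) * Real.log (1 - x) + (1 + α) * Real.log (1 + x) - (1 - α) * Real.log x

/-- At `√2 - 1`, the double saddle point for `α = 1/√2`, the integrand has the same modulus for
every `α`. -/
theorem logModulus_sqrt_two_sub_one (α : ℝ) : logModulus α (√2 - 1) = Real.log 2 := by
  have h2 : 1 < √2 := Real.lt_sqrt_of_sq_lt (by norm_num)
  have hs : √2 * √2 = 2 := Real.mul_self_sqrt (by norm_num)
  have e1 : 1 - (√2 - 1) = √2 * (√2 - 1) := by linear_combination -hs
  have e2 : Real.log 2 = 2 * Real.log √2 := by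
    rw [Real.log_sqrt (by norm_num)]; ring
  rw [logModulus, e1, Real.log_mul (by linarith) (by linarith), e2,
    show 1 + (√2 - 1) = √2 by ring]
  ring

/-- Along the real axis the modulus increases from the saddle point towards the larger saddle
point, which lies beyond `√2 - 1`. -/
theorem logModulus_strictMonoOn {α : ℝ} (h1 : 1 / √2 < α) (h2 : α < 1) :
    StrictMonoOn (logModulus α) (Set.Icc (saddle α) (√2 - 1)) := by
  have hz := saddle_pos h1 h2
  have hlt := saddle_lt h1 h2
  have hs2 := sqrt_two_lt
  have hs : √2 * √2 = 2 := Real.mul_self_sqrt (by norm_num)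
  have hs1 : 1 < √2 := Real.lt_sqrt_of_sq_lt (by norm_num)
  have hq := saddle_quadratic h1
  have hα : 1 < α * √2 := by rwa [div_lt_iff₀ (by linarith)] at h1
  have hder : ∀ x ∈ Set.Icc (saddle α) (√2 - 1), HasDerivAt (logModulus α)
      ((1 - α) * (-1 / (1 - x)) + (1 + α) * (1 / (1 + x)) - (1 - α) * (1 / x)) x := by
    intro x hx
    have h3 : 0 < x := lt_of_lt_of_le hz hx.1
    have h4 : x < 1 := by linarith [hx.2]
    exact (((((hasDerivAt_id x).const_sub 1).log (by simp; linarith)).const_mul (1 - α)).add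
      ((((hasDerivAt_id x).const_add 1).log (by simp; linarith)).const_mul (1 + α))).sub
      (((hasDerivAt_id x).log (by simp; linarith)).const_mul (1 - α))
  refine strictMonoOn_of_deriv_pos (convex_Icc _ _)
    (fun x hx => (hder x hx).continuousAt.continuousWithinAt) fun x hx => ?_
  rw [interior_Icc] at hx
  rw [(hder x ⟨hx.1.le, hx.2.le⟩).deriv]
  have h3 : 0 < x := hz.trans hx.1
  have h4 : x < 1 := by linarith [hx.2]
  have e : (1 - α) * (-1 / (1 - x)) + (1 + α) * (1 / (1 + x)) - (1 - α) * (1 / x) =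
      (2 * α * x - (1 + α) * x ^ 2 - (1 - α)) / (x * (1 - x) * (1 + x)) := by
    have : 1 - x ≠ 0 := by linarith
    field_simp
    ring
  rw [e]
  refine div_pos ?_ (mul_pos (mul_pos h3 (by linarith)) (by linarith))
  -- both `x` and the saddle point lie below `√2 - 1 < α / (1 + α)`, the mean of the two roots
  have h5 : (√2 - 1) * (1 + α) < α := by nlinarith
  have h6 : (1 + α) * (x + saddle α) < 2 * α := by nlinarith [hx.2]
  have h7 : 2 * α * x - (1 + α) * x ^ 2 - (1 - α) =
      (x - saddle α) * (2 * α - (1 + α) * (x + saddle α)) := by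
    linear_combination -hq
  rw [h7]
  exact mul_pos (by linarith [hx.1]) (by linarith)

theorem B_lt_one {α : ℝ} (h1 : 1 / √2 < α) (h2 : α < 1) : B α < 1 := by
  have hz := saddle_pos h1 h2
  have hz2 := saddle_lt_half h1 h2
  have hlt := saddle_lt h1 h2
  have hmono := logModulus_strictMonoOn h1 h2 ⟨le_rfl, hlt.le⟩ ⟨hlt.le, le_rfl⟩ hlt
  rw [logModulus_sqrt_two_sub_one] at hmono
  have hlog : Real.log (B α) = (logModulus α (saddle α) - Real.log 2) / 2 := by
    have n1 : (1 - saddle α) ≠ 0 := by linarith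
    have n2 : (1 + saddle α) ≠ 0 := by linarith
    have hb : 0 < (1 - saddle α ^ 2) / (2 * saddle α) := div_pos (by nlinarith) (by positivity)
    have hp2 : (0 : ℝ) < 1 + saddle α := by linarith
    rw [B_eq h1 h2, Real.log_mul (by positivity) (by positivity),
      Real.log_mul (by positivity) (by positivity), Real.log_rpow (by norm_num),
      Real.log_rpow hp2, Real.log_rpow hb, show 1 - saddle α ^ 2 = (1 - saddle α) * (1 + saddle α)
      by ring, Real.log_div (by positivity) (by positivity), Real.log_mul n1 n2,
      Real.log_mul (by norm_num) hz.ne', logModulus]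
    ring
  rw [← Real.log_neg_iff (B_pos h1 h2), hlog]
  linarith

/-- By compactness the base stays away from `1` on the whole range. -/
theorem exists_B_le {ε : ℝ} (hε : 0 < ε) :
    ∃ q : ℝ, 0 < q ∧ q < 1 ∧ ∀ α ∈ Set.Icc (1 / √2 + ε) (1 - ε), B α ≤ q := by
  rcases (Set.Icc (1 / √2 + ε) (1 - ε)).eq_empty_or_nonempty with h | h
  · exact ⟨1 / 2, by norm_num, by norm_num, fun α hα => by rw [h] at hα; exact absurd hα (Set.notMem_empty α)⟩
  have hc : ContinuousOn B (Set.Icc (1 / √2 + ε) (1 - ε)) := by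
    have hp := inv_sqrt_two_pos
    have hden : ∀ α ∈ Set.Icc (1 / √2 + ε) (1 - ε), 1 + α ≠ 0 := fun α hα => by
      linarith [hα.1]
    have hden' : ∀ α ∈ Set.Icc (1 / √2 + ε) (1 - ε), 1 - α ^ 2 ≠ 0 := fun α hα => by
      nlinarith [hα.1, hα.2]
    unfold B
    refine ((by fun_prop : Continuous _).continuousOn.rpow (by fun_prop) (by simp)
      |>.mul (ContinuousOn.rpow (ContinuousOn.div (by fun_prop) (by fun_prop) hden)
        (by fun_prop) fun α hα => Or.inl ?_)).mul
      (ContinuousOn.rpow (ContinuousOn.div (by fun_prop) (by fun_prop) hden')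
        (by fun_prop) fun α hα => Or.inr ?_)
    · have h1 : 1 / √2 < α := by linarith [hα.1]
      have h2 : α < 1 := by linarith [hα.2]
      have := disc_lt h1 h2
      rw [disc] at this
      exact div_ne_zero (by linarith) (hden α hα)
    · linarith [hα.2]
  obtain ⟨β, hβ, hmax⟩ := isCompact_Icc.exists_isMaxOn h hc
  have h1 : 1 / √2 < β := by linarith [hβ.1]
  have h2 : β < 1 := by linarith [hβ.2]
  exact ⟨B β, B_pos h1 h2, B_lt_one h1 h2, fun α hα => hmax hα⟩

/-- The amplitude `x` at time `t` is `C t^{-1/2} b^t (1 + O(1/t))` with constant `K`; the plain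
exponential bound with the same constant is recorded along with it. -/
def HasAsymptotics (K x C b : ℝ) (t : ℕ) : Prop :=
  (∃ ρ : ℝ, |ρ| ≤ K / (t : ℝ) ∧ x = C * (1 / √(t : ℝ)) * b ^ t * (1 + ρ)) ∧ |x| ≤ K * b ^ t

theorem hasAsymptotics_of_abs_sub_le {K₀ c₀ c₁ x C b : ℝ} {t : ℕ} (hK : 0 ≤ K₀) (hc₀ : 0 < c₀)
    (hC₀ : c₀ ≤ C) (hC₁ : C ≤ c₁) (hb : 0 < b) (ht : 0 < t)
    (h : |x - C * (1 / √(t : ℝ)) * b ^ t| ≤ K₀ / (t * √(t : ℝ)) * b ^ t) :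
    HasAsymptotics (K₀ / c₀ + c₁ + K₀) x C b t := by
  have hC : 0 < C := hc₀.trans_le hC₀
  have ht1 : (1 : ℝ) ≤ t := by exact_mod_cast ht
  have hts : 1 ≤ √(t : ℝ) := Real.one_le_sqrt.mpr ht1
  have htp : (0 : ℝ) < t := by linarith
  have hsp : 0 < √(t : ℝ) := by linarith
  have hbt : 0 < b ^ t := pow_pos hb t
  set m := C * (1 / √(t : ℝ)) * b ^ t with hm
  have hm0 : 0 < m := by positivity
  constructor
  · refine ⟨(x - m) / m, ?_, by rw [mul_add, mul_one, mul_div_cancel₀ _ hm0.ne']; ring⟩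
    rw [abs_div, abs_of_pos hm0]
    calc |x - m| / m ≤ K₀ / (t * √(t : ℝ)) * b ^ t / m := by gcongr
      _ = K₀ / C / t := by rw [hm]; field_simp
      _ ≤ K₀ / c₀ / t := by gcongr
      _ ≤ (K₀ / c₀ + c₁ + K₀) / t := by gcongr; linarith
  · have hm1 : m ≤ c₁ * b ^ t := by
      rw [hm]
      gcongr
      calc C * (1 / √(t : ℝ)) ≤ C * 1 := by
            gcongr; rw [div_le_one hsp]; exact hts
        _ ≤ c₁ := by linarith
    have h2 : K₀ / (t * √(t : ℝ)) * b ^ t ≤ K₀ * b ^ t := by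
      gcongr
      exact div_le_self hK (by nlinarith)
    have h3 : |x| ≤ |x - m| + m := by
      have := abs_add_le (x - m) m
      rwa [sub_add_cancel, abs_of_pos hm0] at this
    have h4 : 0 ≤ K₀ / c₀ * b ^ t := by positivity
    nlinarith

/-- Uniform asymptotics of a coefficient whose contour integrand is the saddle point integrand
times a smooth prefactor `g` with value `g₀` at the saddle point. -/
theorem exists_coeff_hasAsymptotics {ε : ℝ} (hε : 0 < ε) :
    ∃ K : ℝ, 0 ≤ K ∧ ∀ (l r : ℕ) (α : ℝ), 0 < l + r → α = ((r : ℝ) - l) / (l + r : ℕ) →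
      α ∈ Set.Icc (1 / √2 + ε) (1 - ε) →
      ∀ (p : ℝ[X]) (m : ℕ) (g : ℝ → ℂ) (g₀ g₁ : ℝ), Continuous g → ε / 4 ≤ g₀ → g₀ ≤ 2 →
      |g₁| ≤ 6 → (∀ θ : ℝ, ‖g θ - g₀ - I * g₁ * θ‖ ≤ 30 * θ ^ 2) →
      (∀ θ : ℝ, aeval ((saddle α : ℂ) * exp (θ * I)) p / ((saddle α : ℂ) * exp (θ * I)) ^ m =
        g θ * ((1 - saddle α * exp (θ * I)) ^ l * (1 + saddle α * exp (θ * I)) ^ r /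
          (saddle α * exp (θ * I)) ^ l)) →
      HasAsymptotics K (p.coeff m / √2 ^ (l + r)) (g₀ / √(2 * Real.pi * curvature α)) (B α)
        (l + r) := by
  have hpi := Real.pi_pos
  set κ := ε ^ 2 / 10 with hκ
  have hκ0 : 0 < κ := by positivity
  set K₀ := laplaceConst κ 222 * √(2 * Real.pi / κ) with hK₀
  have hK₀0 : 0 ≤ K₀ := by rw [hK₀, laplaceConst]; positivity
  set c₀ := ε / 4 / √(2 * Real.pi) with hc₀
  have hc₀0 : 0 < c₀ := by positivity
  set c₁ := 2 / √(2 * Real.pi * (ε ^ 2 / 2)) with hc₁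
  refine ⟨K₀ / c₀ + c₁ + K₀, by positivity, ?_⟩
  intro l r α ht hα hr p m g g₀ g₁ hgc hg₀ hg₀' hg₁ hg hint
  have h1 : 1 / √2 < α := by linarith [hr.1]
  have h2 : α < 1 := by linarith [hr.2]
  have hz := saddle_pos h1 h2
  have hz2 := saddle_lt_half h1 h2
  have hv := curvature_ge hε hr
  have hv1 := curvature_le_one h1 h2
  have hv0 : 0 < curvature α := lt_of_lt_of_le (by positivity) hv
  have hb : |saddle α| ≤ 1 / 2 := by rw [abs_of_pos hz]; exact hz2.le
  have htp : (0 : ℝ) < ((l + r : ℕ) : ℝ) := by exact_mod_cast ht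
  have hg₀p : 0 ≤ g₀ := by linarith
  have hsq : √(2 * Real.pi * curvature α) ≤ √(2 * Real.pi) := Real.sqrt_le_sqrt (by nlinarith)
  refine hasAsymptotics_of_abs_sub_le hK₀0 hc₀0 (by rw [hc₀]; gcongr)
    (by rw [hc₁]; gcongr) (B_pos h1 h2) ht ?_
  set t := l + r with htdef
  set c := (1 - α) / 2 * logCubic (-saddle α) + (1 + α) / 2 * logCubic (saddle α) with hc
  have hc222 : |c| ≤ 222 := by
    have a1 := abs_le.mp (abs_logCubic_le (by rwa [abs_neg] : |-saddle α| ≤ 1 / 2))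
    have a2 := abs_le.mp (abs_logCubic_le hb)
    have hα0 : 0 < α := inv_sqrt_two_pos.trans h1
    exact abs_le.mpr ⟨by nlinarith, by nlinarith⟩
  have hL := norm_laplace_integral_sub_le (κ := κ) (M := 222) (v := curvature α) (c := c)
    (g₀ := g₀) (g₁ := g₁) (t := t) (φ := phase α) (g := g) hκ0 (by norm_num)
    (by rw [hκ]; linarith [sq_nonneg ε]) hc222
    (by rw [abs_of_pos (by linarith)]; linarith) (hg₁.trans (by norm_num)) htp
    (continuous_phase h1 h2) hgc (norm_phase_sub_le h1 h2)
    (fun θ hθ => (re_phase_le h1 h2 hθ).trans (by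
      have : ε ^ 2 / 10 * θ ^ 2 ≤ curvature α / 5 * θ ^ 2 :=
        mul_le_mul_of_nonneg_right (by linarith) (sq_nonneg θ)
      rw [hκ]; linarith))
    (fun θ => (hg θ).trans (by gcongr; norm_num))
  have hcoef := coeff_eq_integral p m (saddle α) hz
  have hcongr : ∀ θ : ℝ,
      aeval ((saddle α : ℂ) * exp (θ * I)) p / ((saddle α : ℂ) * exp (θ * I)) ^ m =
      saddleValue (saddle α) l r * (g θ * exp ((t : ℝ) * phase α θ)) := by
    intro θ
    rw [hint θ, integrand_eq_exp_phase h1 h2 ht hα θ]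
    ring
  simp only [hcongr] at hcoef
  rw [intervalIntegral.integral_const_mul] at hcoef
  set J := ∫ θ in (-Real.pi)..Real.pi, g θ * exp ((t : ℝ) * phase α θ) with hJ
  set Q := saddleValue (saddle α) l r with hQ
  have hB : Q = B α ^ t * √2 ^ t := by
    rw [B_pow h1 h2 ht hα, ← htdef, ← hQ]; field_simp
  have hBpos : 0 < B α ^ t := pow_pos (B_pos h1 h2) t
  have hQ0 : 0 < Q := by rw [hB]; positivity
  have hJr : J = ((2 * Real.pi * p.coeff m / Q : ℝ) : ℂ) := by
    have : (Q : ℂ) ≠ 0 := by exact_mod_cast hQ0.ne'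
    push_cast
    rw [eq_div_iff this, mul_comm, hcoef]
  rw [hJr, ← ofReal_sub, norm_real, Real.norm_eq_abs, ← hK₀] at hL
  have hgauss : √(2 * Real.pi / (t * curvature α)) =
      2 * Real.pi * (1 / √(2 * Real.pi * curvature α) * (1 / √(t : ℝ))) := by
    rw [← Real.sqrt_one, ← Real.sqrt_div' _ (by positivity), ← Real.sqrt_div' _ htp.le,
      ← Real.sqrt_mul' _ (by positivity), ← Real.sqrt_sq (by positivity : 0 ≤ 2 * Real.pi),
      ← Real.sqrt_mul (by positivity), Real.sqrt_sq (by positivity)]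
    congr 1
    field_simp
  rw [hgauss] at hL
  have hid : p.coeff m / √2 ^ t - g₀ / √(2 * Real.pi * curvature α) * (1 / √(t : ℝ)) * B α ^ t =
      (2 * Real.pi * p.coeff m / Q - g₀ * (2 * Real.pi *
        (1 / √(2 * Real.pi * curvature α) * (1 / √(t : ℝ))))) * B α ^ t / (2 * Real.pi) := by
    rw [hB]
    field_simp
  rw [hid, abs_div, abs_mul, abs_of_pos hBpos, abs_of_pos (by positivity : 0 < 2 * Real.pi)]
  calc _ ≤ K₀ / (t * √(t : ℝ)) * B α ^ t / (2 * Real.pi) := by gcongr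
    _ ≤ K₀ / (t * √(t : ℝ)) * B α ^ t :=
        div_le_self (by positivity) (by linarith [Real.pi_gt_three])

end HadamardWalk

/-! ### The constants and the asymptotics of the amplitudes -/

namespace HadamardWalk

open Complex Polynomial

theorem one_sub_saddle {α : ℝ} (h1 : 1 / √2 < α) :
    (1 - saddle α) * (1 + α) = 1 + disc α := by linear_combination -saddle_mul h1

theorem one_add_saddle {α : ℝ} (h1 : 1 / √2 < α) :
    (1 + saddle α) * (1 + α) = 1 + 2 * α - disc α := by linear_combination saddle_mul h1

theorem coin_ratio_eq {α : ℝ} (h1 : 1 / √2 < α) :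
    (1 + √(2 * α ^ 2 - 1)) / (1 + 2 * α - √(2 * α ^ 2 - 1)) =
      (1 - saddle α) / (1 + saddle α) := by
  have hp := inv_sqrt_two_pos
  change (1 + disc α) / (1 + 2 * α - disc α) = _
  rw [← one_sub_saddle h1, ← one_add_saddle h1, mul_div_mul_right _ _ (by linarith)]

theorem CL_eq {α : ℝ} (h1 : 1 / √2 < α) (h2 : α < 1) :
    CL α = ((1 + -saddle α)⁻¹ - 1) / √(2 * Real.pi * curvature α) := by
  have hp := inv_sqrt_two_pos
  have hz := saddle_pos h1 h2
  have hz2 := saddle_lt_half h1 h2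
  have hd := disc_pos h1
  have n1 : 0 < 1 - saddle α := by linarith
  have n2 : 1 - saddle α ^ 2 ≠ 0 := by nlinarith
  have n3 : 0 < 1 + α := by linarith
  have hg : (1 + -saddle α)⁻¹ - 1 = saddle α / (1 - saddle α) := by
    rw [← sub_eq_add_neg]; field_simp; ring
  have hg0 : 0 ≤ saddle α / (1 - saddle α) := by positivity
  rw [hg, ← Real.sqrt_sq hg0, ← Real.sqrt_div (by positivity)]
  change √((α - disc α) * (1 + 2 * α - disc α) /
    (2 * Real.pi * disc α * (1 + α) * (1 + disc α))) = _
  congr 1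
  rw [← saddle_mul h1, ← one_add_saddle h1, ← one_sub_saddle h1, curvature]
  have hpi := Real.pi_pos
  field_simp
  ring

/-- The saddle point equation in the form `(1 + α) / (1 - α) = (1 + ζ) / (ζ (1 - ζ))`. -/
theorem speed_ratio_eq {α : ℝ} (h1 : 1 / √2 < α) :
    (1 + α) * (saddle α * (1 - saddle α)) = (1 - α) * (1 + saddle α) := by
  linear_combination speed_eq_saddle h1

theorem CR_eq {α : ℝ} (h1 : 1 / √2 < α) (h2 : α < 1) :
    CR α = (1 + -saddle α)⁻¹ / √(2 * Real.pi * curvature α) := by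
  have hz := saddle_pos h1 h2
  have hz2 := saddle_lt_half h1 h2
  have n1 : 1 - saddle α ≠ 0 := by linarith
  have n2 : 1 + saddle α ≠ 0 := by linarith
  have n3 : 1 - α ≠ 0 := by linarith
  have key : (1 + α) / (1 - α) * ((1 - saddle α) / (1 + saddle α)) = 1 / saddle α := by
    rw [div_mul_div_comm, div_eq_div_iff (mul_ne_zero n3 n2) hz.ne']
    linear_combination speed_ratio_eq h1
  rw [CR, coin_ratio_eq h1, key, CL_eq h1 h2, ← mul_div_assoc, ← sub_eq_add_neg]
  congr 1
  field_simp
  ring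

theorem CLneg_eq {α : ℝ} (h1 : 1 / √2 < α) (h2 : α < 1) :
    CLneg α = (1 + saddle α)⁻¹ / √(2 * Real.pi * curvature α) := by
  have hp := inv_sqrt_two_pos
  have hz := saddle_pos h1 h2
  have hz2 := saddle_lt_half h1 h2
  have n1 : 1 - saddle α ≠ 0 := by linarith
  have n2 : 1 + saddle α ≠ 0 := by linarith
  have n3 : 1 - α ≠ 0 := by linarith
  have key : (α + √(2 * α ^ 2 - 1)) / (1 - α) = 1 / saddle α := by
    change (α + disc α) / (1 - α) = _
    rw [div_eq_div_iff n3 hz.ne']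
    refine mul_left_cancel₀ (by linarith : 1 + α ≠ 0) ?_
    linear_combination (α + disc α) * saddle_mul h1 - disc_sq h1
  rw [CLneg, coin_ratio_eq h1, key, CL_eq h1 h2, ← mul_div_assoc, ← sub_eq_add_neg]
  congr 1
  field_simp
  ring

theorem CRneg_eq {α : ℝ} (h1 : 1 / √2 < α) (h2 : α < 1) :
    CRneg α = (1 - (1 + saddle α)⁻¹) / √(2 * Real.pi * curvature α) := by
  have hp := inv_sqrt_two_pos
  have hz := saddle_pos h1 h2
  have hz2 := saddle_lt_half h1 h2
  have n1 : 1 - saddle α ≠ 0 := by linarith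
  have n2 : 1 + saddle α ≠ 0 := by linarith
  have n3 : 1 + α ≠ 0 := by linarith
  have key : (1 - α) / (1 + α) = saddle α * (1 - saddle α) / (1 + saddle α) := by
    rw [div_eq_div_iff n3 n2]
    linear_combination -speed_ratio_eq h1
  rw [CRneg, CR_eq h1 h2, key, ← mul_div_assoc, ← sub_eq_add_neg]
  congr 1
  field_simp
  ring

/-- The four coefficient asymptotics behind the two amplitudes in the two ranges, for `l + 1` moves
to the left and `r + 1` moves to the right. -/
theorem exists_hasAsymptotics {ε : ℝ} (hε : 0 < ε) :
    ∃ K : ℝ, 0 ≤ K ∧ ∀ (l r : ℕ) (α : ℝ),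
      α = (((r + 1 : ℕ) : ℝ) - (l + 1 : ℕ)) / ((l + 1) + (r + 1) : ℕ) →
      α ∈ Set.Icc (1 / √2 + ε) (1 - ε) →
      (HasAsymptotics K (((1 - X : ℝ[X]) ^ l * (1 + X) ^ (r + 1)).coeff l /
          √2 ^ ((l + 1) + (r + 1))) (CL α) (B α) ((l + 1) + (r + 1)) ∧
        HasAsymptotics K (((1 - X : ℝ[X]) ^ l * (1 + X) ^ (r + 1)).coeff (l + 1) /
          √2 ^ ((l + 1) + (r + 1))) (CR α) (B α) ((l + 1) + (r + 1))) ∧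
      (HasAsymptotics K (((1 - X : ℝ[X]) ^ (l + 1) * (1 + X) ^ r).coeff (l + 1) /
          √2 ^ ((l + 1) + (r + 1))) (CLneg α) (B α) ((l + 1) + (r + 1)) ∧
        HasAsymptotics K (((1 - X : ℝ[X]) ^ (l + 1) * (1 + X) ^ r).coeff l /
          √2 ^ ((l + 1) + (r + 1))) (CRneg α) (B α) ((l + 1) + (r + 1))) := by
  obtain ⟨K, hK, h⟩ := exists_coeff_hasAsymptotics hε
  refine ⟨K, hK, fun l r α hα hr => ?_⟩
  have h1 : 1 / √2 < α := by linarith [hr.1]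
  have h2 : α < 1 := by linarith [hr.2]
  have hz := saddle_pos h1 h2
  have hz2 := saddle_lt_half h1 h2
  have hzε := saddle_ge hε hr
  have hε1 : ε < 1 := by linarith [hr.2, inv_sqrt_two_pos]
  have hb : |saddle α| ≤ 1 / 2 := by rw [abs_of_pos hz]; exact hz2.le
  have hb' : |-saddle α| ≤ 1 / 2 := by rwa [abs_neg]
  have H := h (l + 1) (r + 1) α (by omega) hα hr
  have inv1 : saddle α ≤ (1 + -saddle α)⁻¹ - 1 := by
    rw [le_sub_iff_add_le, inv_eq_one_div, le_div_iff₀ (by linarith)]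
    nlinarith
  have inv2 : (1 + saddle α)⁻¹ ≤ 1 - saddle α / 2 := by
    rw [inv_le_iff_one_le_mul₀ (by linarith)]
    nlinarith
  have inv3 : 1 / 2 ≤ (1 + saddle α)⁻¹ := by
    rw [le_inv_comm₀ (by norm_num) (by linarith)]
    norm_num
    linarith
  have a1 := abs_le.mp (abs_inv_one_add_le hb')
  have a2 := abs_le.mp (abs_inv_one_add_le hb)
  -- the values at `0` and the derivatives of the prefactors
  have d1 := norm_circInv_sub_le hb'
  have d2 := norm_circInv_sub_le hb
  rw [circInv_zero] at d1 d2
  set u := (1 + -saddle α)⁻¹ with hu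
  set w := (1 + saddle α)⁻¹ with hw
  have m1 : |u - u ^ 2| ≤ 6 := abs_le.mpr ⟨by nlinarith, by nlinarith⟩
  have m2 : |w - w ^ 2| ≤ 6 := abs_le.mpr ⟨by nlinarith, by nlinarith⟩
  have nz : ∀ θ : ℝ, (saddle α : ℂ) * exp (θ * I) ≠ 0 := fun θ =>
    mul_ne_zero (by exact_mod_cast hz.ne') (exp_ne_zero _)
  have n1 : ∀ θ : ℝ, 1 - (saddle α : ℂ) * exp (θ * I) ≠ 0 := fun θ => by
    have := slitPlane_ne_zero (one_add_mem_slitPlane hb' θ)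
    rwa [ofReal_neg, neg_mul, ← sub_eq_add_neg] at this
  have n2 : ∀ θ : ℝ, 1 + (saddle α : ℂ) * exp (θ * I) ≠ 0 := fun θ =>
    slitPlane_ne_zero (one_add_mem_slitPlane hb θ)
  have g1 : ∀ θ : ℝ, circInv (-saddle α) θ = (1 - (saddle α : ℂ) * exp (θ * I))⁻¹ := fun θ => by
    rw [circInv, ofReal_neg, neg_mul, ← sub_eq_add_neg]
  rw [CL_eq h1 h2, CR_eq h1 h2, CLneg_eq h1 h2, CRneg_eq h1 h2]
  refine ⟨⟨?_, ?_⟩, ?_, ?_⟩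
  · refine H _ _ (fun θ => circInv (-saddle α) θ - 1) (u - 1) (-(u - u ^ 2))
      ((continuous_circInv hb').sub continuous_const) (by linarith) (by linarith)
      (by rwa [abs_neg]) (fun θ => ?_) fun θ => ?_
    · refine Eq.trans_le ?_ (d1 θ)
      congr 1; push_cast; ring
    · have := nz θ
      have := n1 θ
      rw [g1]
      simp only [map_mul, map_pow, map_sub, map_add, map_one, aeval_X]
      generalize (saddle α : ℂ) * exp (θ * I) = z at *
      field_simp
      ring
  · refine H _ _ (circInv (-saddle α)) u (-(u - u ^ 2))
      (continuous_circInv hb') (by linarith) (by linarith)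
      (by rwa [abs_neg]) (fun θ => ?_) fun θ => ?_
    · refine Eq.trans_le ?_ (d1 θ)
      congr 1; push_cast; ring
    · have := nz θ
      have := n1 θ
      rw [g1]
      simp only [map_mul, map_pow, map_sub, map_add, map_one, aeval_X]
      generalize (saddle α : ℂ) * exp (θ * I) = z at *
      field_simp
      ring
  · refine H _ _ (circInv (saddle α)) w (-(w - w ^ 2))
      (continuous_circInv hb) (by linarith) (by linarith)
      (by rwa [abs_neg]) (fun θ => ?_) fun θ => ?_
    · refine Eq.trans_le ?_ (d2 θ)
      congr 1; push_cast; ring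
    · have := nz θ
      have := n2 θ
      rw [circInv]
      simp only [map_mul, map_pow, map_sub, map_add, map_one, aeval_X]
      generalize (saddle α : ℂ) * exp (θ * I) = z at *
      field_simp
      ring
  · refine H _ _ (fun θ => 1 - circInv (saddle α) θ) (1 - w) (w - w ^ 2)
      (continuous_const.sub (continuous_circInv hb)) (by linarith) (by linarith)
      m2 (fun θ => ?_) fun θ => ?_
    · rw [← norm_neg]
      refine Eq.trans_le ?_ (d2 θ)
      congr 1; push_cast; ring
    · have := nz θ
      have := n2 θ
      rw [circInv]
      simp only [map_mul, map_pow, map_sub, map_add, map_one, aeval_X]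
      generalize (saddle α : ℂ) * exp (θ * I) = z at *
      field_simp
      ring

/-- A lattice point of the right parity strictly inside the light cone is reached by at least one
move in each direction. -/
theorem exists_moves {t : ℕ} {n : ℤ} (hpar : n ≡ (t : ℤ) [ZMOD 2]) (h : |n| < (t : ℤ)) :
    ∃ l r : ℕ, (l + 1) + (r + 1) = t ∧ ((r + 1 : ℕ) : ℤ) - (l + 1 : ℕ) = n := by
  rw [abs_lt] at h
  rw [Int.ModEq] at hpar
  exact ⟨((t - n) / 2 - 1).toNat, ((t + n) / 2 - 1).toNat, by omega, by omega⟩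

theorem abs_lt_of_abs_div_lt {t : ℕ} {n : ℤ} (h0 : n / (t : ℝ) ≠ 0) (h : |n / (t : ℝ)| < 1) :
    |n| < (t : ℤ) := by
  have ht : (0 : ℝ) < t := by
    refine lt_of_le_of_ne (Nat.cast_nonneg t) fun h1 => h0 ?_
    rw [← h1, div_zero]
  rw [abs_div, abs_of_pos ht, div_lt_one ht] at h
  exact_mod_cast h

theorem exists_right_hasAsymptotics {ε : ℝ} (hε : 0 < ε) :
    ∃ K : ℝ, 0 ≤ K ∧ ∀ (t : ℕ) (n : ℤ), n ≡ (t : ℤ) [ZMOD 2] →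
      (n : ℝ) / t ∈ Set.Icc (1 / √2 + ε) (1 - ε) →
      HasAsymptotics K (ψL n t) (CL (n / t)) (B (n / t)) t ∧
        HasAsymptotics K (ψR n t) (CR (n / t)) (B (n / t)) t := by
  obtain ⟨K, hK, h⟩ := exists_hasAsymptotics hε
  refine ⟨K, hK, fun t n hpar hr => ?_⟩
  have hp := inv_sqrt_two_pos
  have h0 : 0 < (n : ℝ) / t := by linarith [hr.1]
  obtain ⟨l, r, rfl, rfl⟩ := exists_moves hpar
    (abs_lt_of_abs_div_lt h0.ne' (by rw [abs_of_pos h0]; linarith [hr.2]))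
  have hΨ := Ψ_eq_coeff _ (l + 1) (r + 1) rfl
  rw [ψL, ψR, hΨ.1, hΨ.2]
  exact (h l r _ (by push_cast; ring) hr).1

theorem exists_left_hasAsymptotics {ε : ℝ} (hε : 0 < ε) :
    ∃ K : ℝ, 0 ≤ K ∧ ∀ (t : ℕ) (n : ℤ), n ≡ (t : ℤ) [ZMOD 2] →
      -((n : ℝ) / t) ∈ Set.Icc (1 / √2 + ε) (1 - ε) →
      HasAsymptotics K ((-1) ^ (t + 1) * ψL n t) (CLneg (-(n / t))) (B (-(n / t))) t ∧
        HasAsymptotics K ((-1) ^ t * ψR n t) (CRneg (-(n / t))) (B (-(n / t))) t := by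
  obtain ⟨K, hK, h⟩ := exists_hasAsymptotics hε
  refine ⟨K, hK, fun t n hpar hr => ?_⟩
  have hp := inv_sqrt_two_pos
  have h0 : (n : ℝ) / t < 0 := by linarith [hr.1]
  obtain ⟨l, r, rfl, rfl⟩ := exists_moves hpar
    (abs_lt_of_abs_div_lt h0.ne (by rw [abs_of_neg h0]; linarith [hr.2]))
  have hΨ := Ψ_eq_coeff _ (l + 1) (r + 1) rfl
  rw [ψL, ψR, hΨ.1, hΨ.2, leftCoeff_eq_reversed, rightCoeff_eq_reversed]
  -- reflection exchanges the numbers of moves to the left and to the right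
  have H := (h r l _ (by push_cast; ring) hr).2
  rw [add_comm (r + 1) (l + 1)] at H
  have s1 : ((-1 : ℝ)) ^ ((l + 1) + (r + 1) + 1) * (-1) ^ (l + (r + 1)) = 1 := by
    rw [← pow_add]; exact Even.neg_one_pow ⟨l + r + 2, by ring⟩
  have s2 : ((-1 : ℝ)) ^ ((l + 1) + (r + 1)) * (-1) ^ (l + r) = 1 := by
    rw [← pow_add]; exact Even.neg_one_pow ⟨l + r + 1, by ring⟩
  rw [mul_div_assoc, ← mul_assoc, s1, one_mul, mul_div_assoc, ← mul_assoc, s2, one_mul]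
  exact H

end HadamardWalk

theorem theorem6 (ε : ℝ) (hε : 0 < ε) :
    -- the base lies strictly between 0 and 1 on the whole range
    (∀ α ∈ Set.Icc (1 / √2 + ε) (1 - ε), 0 < HadamardWalk.B α ∧ HadamardWalk.B α < 1) ∧
    -- right range
    (∃ K : ℝ, ∃ T : ℕ, ∀ t : ℕ, T ≤ t → ∀ n : ℤ, n ≡ (t : ℤ) [ZMOD 2] →
      ∀ α : ℝ, α = (n : ℝ) / (t : ℝ) → α ∈ Set.Icc (1 / √2 + ε) (1 - ε) →
        (∃ r : ℝ, |r| ≤ K / (t : ℝ) ∧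
          HadamardWalk.ψR n t =
            HadamardWalk.CR α * (1 / √(t : ℝ)) * HadamardWalk.B α ^ t * (1 + r)) ∧
        (∃ r : ℝ, |r| ≤ K / (t : ℝ) ∧
          HadamardWalk.ψL n t =
            HadamardWalk.CL α * (1 / √(t : ℝ)) * HadamardWalk.B α ^ t * (1 + r))) ∧
    -- left range
    (∃ K : ℝ, ∃ T : ℕ, ∀ t : ℕ, T ≤ t → ∀ n : ℤ, n ≡ (t : ℤ) [ZMOD 2] →
      ∀ α : ℝ, α = (n : ℝ) / (t : ℝ) → α ∈ Set.Icc (-1 + ε) (-(1 / √2) - ε) →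
        (∃ r : ℝ, |r| ≤ K / (t : ℝ) ∧
          HadamardWalk.ψR n t =
            (-1) ^ t * HadamardWalk.CRneg (-α) * (1 / √(t : ℝ)) *
              HadamardWalk.B (-α) ^ t * (1 + r)) ∧
        (∃ r : ℝ, |r| ≤ K / (t : ℝ) ∧
          HadamardWalk.ψL n t =
            (-1) ^ (t + 1) * HadamardWalk.CLneg (-α) * (1 / √(t : ℝ)) *
              HadamardWalk.B (-α) ^ t * (1 + r))) ∧
    -- uniform exponential decay of the amplitudes in both ranges
    (∃ K q : ℝ, 0 < q ∧ q < 1 ∧ ∃ T : ℕ, ∀ t : ℕ, T ≤ t → ∀ n : ℤ,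
      |(n : ℝ) / (t : ℝ)| ∈ Set.Icc (1 / √2 + ε) (1 - ε) →
        |HadamardWalk.ψR n t| ≤ K * q ^ t ∧ |HadamardWalk.ψL n t| ≤ K * q ^ t) := by
  have hB : ∀ α ∈ Set.Icc (1 / √2 + ε) (1 - ε), 0 < HadamardWalk.B α ∧ HadamardWalk.B α < 1 :=
    fun α hα =>
      have h1 : 1 / √2 < α := by linarith [hα.1]
      have h2 : α < 1 := by linarith [hα.2]
      ⟨HadamardWalk.B_pos h1 h2, HadamardWalk.B_lt_one h1 h2⟩
  obtain ⟨K₁, hK₁, hright⟩ := HadamardWalk.exists_right_hasAsymptotics hε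
  obtain ⟨K₂, hK₂, hleft⟩ := HadamardWalk.exists_left_hasAsymptotics hε
  -- the sign is its own inverse
  have hsign : ∀ (k : ℕ) (x y : ℝ), (-1) ^ k * x = y → x = (-1) ^ k * y := by
    rintro k x _ rfl
    rw [← mul_assoc, ← pow_add, Even.neg_one_pow ⟨k, rfl⟩, one_mul]
  have habs : ∀ (k : ℕ) (x : ℝ), |(-1) ^ k * x| = |x| := fun k x => by
    rw [abs_mul, abs_neg_one_pow, one_mul]
  refine ⟨hB, ⟨K₁, 0, ?_⟩, ⟨K₂, 0, ?_⟩, ?_⟩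
  · rintro t - n hpar _ rfl hr
    obtain ⟨h1, h2⟩ := hright t n hpar hr
    exact ⟨h2.1, h1.1⟩
  · rintro t - n hpar _ rfl hr
    obtain ⟨⟨⟨ρ, hρ, e⟩, -⟩, ⟨ρ', hρ', e'⟩, -⟩ :=
      hleft t n hpar ⟨by linarith [hr.2], by linarith [hr.1]⟩
    refine ⟨⟨ρ', hρ', ?_⟩, ⟨ρ, hρ, ?_⟩⟩
    · rw [hsign _ _ _ e']; ring
    · rw [hsign _ _ _ e]; ring
  · obtain ⟨q, hq0, hq1, hq⟩ := HadamardWalk.exists_B_le hε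
    refine ⟨K₁ + K₂, q, hq0, hq1, 0, ?_⟩
    rintro t - n hr
    by_cases hpar : n ≡ (t : ℤ) [ZMOD 2]
    · have hle : ∀ {K x b : ℝ}, 0 ≤ K → K ≤ K₁ + K₂ → 0 < b → b ≤ q → |x| ≤ K * b ^ t →
          |x| ≤ (K₁ + K₂) * q ^ t := fun hK hKK hb hbq h =>
        h.trans (mul_le_mul hKK (pow_le_pow_left₀ hb.le hbq t) (by positivity) (hK.trans hKK))
      rcases abs_choice ((n : ℝ) / t) with h | h <;> rw [h] at hr
      · obtain ⟨h1, h2⟩ := hright t n hpar hr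
        exact ⟨hle hK₁ (by linarith) (hB _ hr).1 (hq _ hr) h2.2,
          hle hK₁ (by linarith) (hB _ hr).1 (hq _ hr) h1.2⟩
      · obtain ⟨⟨-, h1⟩, -, h2⟩ := hleft t n hpar hr
        rw [habs] at h1 h2
        exact ⟨hle hK₂ (by linarith) (hB _ hr).1 (hq _ hr) h2,
          hle hK₂ (by linarith) (hB _ hr).1 (hq _ hr) h1⟩
    · -- lattice points of the wrong parity are never occupied
      have h0 := HadamardWalk.Ψ_eq_zero t n (Or.inr hpar)
      rw [HadamardWalk.ψR, HadamardWalk.ψL, h0.1, h0.2, abs_zero]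
      have : 0 ≤ (K₁ + K₂) * q ^ t := by positivity
      exact ⟨this, this⟩
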